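/- Let $d\ge 1$, let $R\subset\mathbb{R}^d$ be a measurable set which contains $\mathbf 0$ as an interior point, and let $f,g$ be real-valued measurable functions on $R$. For $\mathbf x\neq \mathbf 0$ write $\rho=|\mathbf x|$ and $\Omega=\mathbf x/\rho\in S^{d-1}$, and let $d\Omega$ be the surface measure on $S^{d-1}$ (counting measure on $\{-1,1\}$ if $d=1$). Suppose that $f(\mathbf 0)=0$, that $f>0$ on $R\setminus\{\mathbf 0\}$, and that for every $\delta>0$ the function $f$ is bounded below by a positive constant on $\{\mathbf x\in R: |\mathbf x|\ge\delta\}$. Suppose further that there are a positive integer $N$, real numbers $\nu>0$ and $\lambda>0$, continuous functions $f_0,\dots,f_N:S^{d-1}\to\mathbb{R}$ with $f_0>0$ everywhere, and functions $g_0,\dots,g_N:S^{d-1}\to\mathbb{R}$ such that, as $\rho\to0^+$, uniformly in $\Omega\in S^{d-1}$, $$f(\rho,\Omega)=\rho^{\nu}\sum_{j=0}^N f_j(\Omega)\rho^j+o(\rho^{N+\nu}),\qquad g(\rho,\Omega)=\rho^{\lambda-d}\sum_{j=0}^N g_j(\Omega)\rho^j+o(\rho^{N+\lambda-d}).$$ Suppose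 finally that $\int_R e^{-k_0f}g\,d^d\mathbf x$ converges absolutely for some $k_0>0$. Then $\rho^{-\nu}f$ is continuous at $\mathbf 0$ (that is, $\lim_{\mathbf x\to\mathbf 0}|\mathbf x|^{-\nu}f(\mathbf x)$ exists and is finite) if and only if the function $f_0$ is constant on $S^{d-1}$. If this is the case, and $f_0>0$ also denotes the constant value, then $\int_R e^{-kf}g\,d^d\mathbf x$ converges absolutely for all $k\ge k_0$, and $$\int_R e^{-kf}g\,d^d\mathbf x=\sum_{j=0}^N\zeta_j k^{-(j+\lambda)/\nu}+o\big(k^{-(N+\lambda)/\nu}\big),\qquad k\to\infty,$$ where $$\zeta_j=\frac1\nu\,\Gamma\Big(\frac{j+\lambda}{\nu}\Big) f_0^{-(j+\lambda)/\nu}\left[\int_{S^{d-1}}g_j\,d\Omega+\sum_{m=1}^{j}\sum_{r=1}^m\binom{-\frac{j+\lambda}{\nu}}{r}f_0^{-r}\int_{S^{d-1}}g_{j-m}(\Omega)f_m^{(r)}(\Omega)\,d\Omega\right],$$ all these spherical integrals being absolutely convergent. Here $\binom{\alpha}{r}=\alpha(\alpha-1)\cdots(\alpha-r+1)/r!$,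 and $$f_m^{(r)}=\sum_{\substack{n_1+\cdots+n_r=m\\ n_i\ge1}}f_{n_1}f_{n_2}\cdots f_{n_r}$$ is the sum of all ordered products of $r$ of the functions $f_1,f_2,\dots$ whose subscripts add to $m$. -/

import Mathlib

open MeasureTheory Filter Topology Asymptotics

/-- The unit sphere `S^{d-1}` of `ℝ^d`. -/
abbrev UnitSphere (d : ℕ) : Type := Metric.sphere (0 : EuclideanSpace ℝ (Fin d)) 1

/-- The surface measure `dΩ` on `S^{d-1}`, normalised so that Lebesgue measure on `ℝ^d` is
`ρ^{d-1} dρ dΩ` (for `d = 1` it is the counting measure on `{-1, 1}`). -/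
noncomputable abbrev sphereMeasure (d : ℕ) : Measure (UnitSphere d) :=
  (volume : Measure (EuclideanSpace ℝ (Fin d))).toSphere

/-- `h(ρ, Ω) = ρ^s ∑_{j=0}^N c_j(Ω) ρ^j + o(ρ^{N+s})` as `ρ → 0⁺`, the error being uniform in
the direction `Ω ∈ S^{d-1}`; here `h(ρ, Ω)` is the value of `h` at the point `ρΩ`. -/
def HasRadialExpansion {d : ℕ} (h : EuclideanSpace ℝ (Fin d) → ℝ) (s : ℝ) (N : ℕ)
    (c : ℕ → UnitSphere d → ℝ) : Prop :=
  (fun p : ℝ × UnitSphere d =>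
      h (p.1 • (p.2 : EuclideanSpace ℝ (Fin d)))
        - p.1 ^ s * ∑ j ∈ Finset.range (N + 1), c j p.2 * p.1 ^ j)
    =o[(𝓝[>] (0 : ℝ)) ×ˢ (⊤ : Filter (UnitSphere d))] fun p => p.1 ^ ((N : ℝ) + s)

/-- `|x|^{-ν} f(x)`, a function on the punctured space, extends continuously to the origin. -/
def RadialQuotientContinuousAtZero {d : ℕ} (f : EuclideanSpace ℝ (Fin d) → ℝ) (ν : ℝ) : Prop :=
  ∃ c : ℝ, Tendsto (fun x => ‖x‖ ^ (-ν) * f x) (𝓝[≠] 0) (𝓝 c)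

/-- `a_m^{(r)}`: the sum of all ordered products `a_{n_1} ⋯ a_{n_r}` with every `n_i ≥ 1` and
`n_1 + ⋯ + n_r = m`. -/
def orderedProductSum (a : ℕ → ℝ) (m r : ℕ) : ℝ :=
  ∑ n ∈ (Finset.Nat.antidiagonalTuple r m).filter (fun n => ∀ i, 1 ≤ n i), ∏ i, a (n i)

/-- The coefficient `ζ_j`. In the term `m = 0` the sum over `1 ≤ r ≤ m` is empty; the convention
that this factor is `1` makes that term equal to `∫ g_j dΩ`. -/
noncomputable def laplaceCoeff {d : ℕ} (ν lam f₀ : ℝ) (fc gc : ℕ → UnitSphere d → ℝ)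
    (j : ℕ) : ℝ :=
  1 / ν * Real.Gamma ((j + lam) / ν) * f₀ ^ (-((j + lam) / ν)) *
    ∑ m ∈ Finset.range (j + 1),
      if m = 0 then ∫ Ω, gc j Ω ∂(sphereMeasure d)
      else ∑ r ∈ Finset.Icc 1 m,
        Ring.choose (-((j + lam) / ν)) r * f₀ ^ (-(r : ℤ)) *
          ∫ Ω, gc (j - m) Ω * orderedProductSum (fun n => fc n Ω) m r ∂(sphereMeasure d)

/-! In polar coordinates put `s = k ρ^ν` and write `ρ^(-ν) f = f₀ + u`, where `f₀` is constant and
`u = ∑_{n ≥ 1} f_n ρ^n + o(ρ^N)`. Then `exp (-k f) = exp (-s f₀) exp (-s u)`. Taylor expansion of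
the second factor to order `N`, multiplied by the expansion of `g`, gives terms `(-k)^r / r!` times
an angular coefficient times `ρ^(ν r + j + λ - d) exp (-k f₀ ρ^ν)`. The radial integral of such a
term is a Gamma integral of size `k^(-r - (j + λ)/ν)`, so the prefactor `k^r` cancels and every `r`
contributes to the same power of `k`. The identity `choose_neg_mul_Gamma` turns `Γ(a + r)` into the
binomial coefficient in `ζ_j`.

The crux is that the error must be uniform in `k`. `expansion_exp_mul` treats `s ≥ 0` as a free
parameter: the powers of `s` and the factor `exp (s |u|)` are paid for with part of the decay `exp
(-s f₀)`. The surviving bound, a small multiple of `ρ^N exp (-s f₀/4)` times an angular function,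
integrates to a small multiple of `k^(-(N + λ)/ν)`. Away from the origin both the true and the model
integrand contribute exponentially little (`isLittleO_integral_exp_neg_mul`).

The `g_j` carry no regularity assumption, so their integrability has to be extracted. Near the
origin `f ≤ 1`, so `g` is integrable there; by Fubini almost every spherical slice of `g` is
integrable. Each slice differs by a bounded function from `∑ g_j ρ^j`, and a Vandermonde inversion
over `N + 1` radii isolates each `g_j` (`integrable_radialCoeff`).

The continuity criterion holds because `ρ^(-ν) f` tends to `f_0(Ω)` uniformly in `Ω`. -/

/-! ### Ordered product sums as coefficients of powers of a series -/

theorem orderedProductSum_zero (a : ℕ → ℝ) (m : ℕ) :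
    orderedProductSum a m 0 = if m = 0 then 1 else 0 := by
  unfold orderedProductSum
  cases m with
  | zero => simp
  | succ m => simp

/-- Splitting off the first factor gives a Cauchy product with the series `∑_{n ≥ 1} a_n ρ^n`; the
`if` removes its constant term. By induction these sums are the coefficients of the `r`-th power of
that series. -/
theorem orderedProductSum_succ (a : ℕ → ℝ) (m r : ℕ) :
    orderedProductSum a m (r + 1) =
      ∑ p ∈ Finset.HasAntidiagonal.antidiagonal m, (if p.1 = 0 then 0 else a p.1) * orderedProductSum a p.2 r := by
  unfold orderedProductSum
  simp only [Finset.mul_sum, Finset.sum_filter]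
  rw [Finset.sum_sigma']
  symm
  refine Finset.sum_bij' (fun q _ => (Fin.cons q.1.1 q.2 : Fin (r + 1) → ℕ))
    (fun n _ => ⟨(n 0, ∑ i, Fin.tail n i), Fin.tail n⟩) ?_ ?_ ?_ ?_ ?_
  · rintro ⟨⟨i, j⟩, n⟩ h
    simp only [Finset.mem_sigma, Finset.HasAntidiagonal.mem_antidiagonal, Finset.Nat.mem_antidiagonalTuple] at h ⊢
    rw [Fin.sum_univ_succ]
    simp [h.1, h.2]
  · intro n h
    rw [Finset.Nat.mem_antidiagonalTuple, Fin.sum_univ_succ] at h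
    simp only [Finset.mem_sigma, Finset.HasAntidiagonal.mem_antidiagonal, Finset.Nat.mem_antidiagonalTuple]
    exact ⟨h, trivial⟩
  · rintro ⟨⟨i, j⟩, n⟩ h
    simp only [Finset.mem_sigma, Finset.HasAntidiagonal.mem_antidiagonal, Finset.Nat.mem_antidiagonalTuple] at h
    simp [h.2]
  · intro n h
    simp
  · rintro ⟨⟨i, j⟩, n⟩ h
    simp only [Fin.forall_fin_succ, Fin.prod_univ_succ, Fin.cons_zero, Fin.cons_succ]
    by_cases hi : i = 0
    · simp [hi]
    · have : 1 ≤ i := Nat.one_le_iff_ne_zero.2 hi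
      simp [hi, this]

theorem orderedProductSum_eq_zero_of_lt (a : ℕ → ℝ) {m r : ℕ} (h : m < r) :
    orderedProductSum a m r = 0 := by
  unfold orderedProductSum
  rw [Finset.filter_eq_empty_iff.2, Finset.sum_empty]
  intro n hn hpos
  rw [Finset.Nat.mem_antidiagonalTuple] at hn
  have : ∑ i : Fin r, 1 ≤ ∑ i, n i := Finset.sum_le_sum fun i _ => hpos i
  simp at this
  omega

/-! ### Algebra of truncated expansions, and the exponential with a free parameter -/

section Expansion

variable {X : Type*} {l : Filter X} {ρ : X → ℝ} {N : ℕ}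

/-- Truncated expansions in powers of `ρ` multiply like polynomials. -/
theorem expansion_mul (hρ : Tendsto ρ l (𝓝 0)) {a b : ℕ → X → ℝ} {u v G : X → ℝ}
    (ha : ∀ j ≤ N, a j =O[l] fun _ => (1 : ℝ)) (hb : ∀ j ≤ N, b j =O[l] G)
    (hu : (fun x => u x - ∑ j ∈ Finset.range (N + 1), a j x * ρ x ^ j) =o[l] fun x => ρ x ^ N)
    (hv : (fun x => v x - ∑ j ∈ Finset.range (N + 1), b j x * ρ x ^ j)
      =o[l] fun x => ρ x ^ N * G x) :
    (fun x => u x * v x - ∑ j ∈ Finset.range (N + 1),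
      (∑ p ∈ Finset.HasAntidiagonal.antidiagonal j, a p.1 x * b p.2 x) * ρ x ^ j)
      =o[l] fun x => ρ x ^ N * G x := by
  have hρ1 : ρ =O[l] fun _ => (1 : ℝ) := hρ.isBigO_one ℝ
  have hρj : ∀ j, (fun x => ρ x ^ j) =O[l] fun _ => (1 : ℝ) := fun j => by
    simpa using hρ1.pow j
  have hU : (fun x => ∑ j ∈ Finset.range (N + 1), a j x * ρ x ^ j) =O[l] fun _ => (1 : ℝ) := by
    refine IsBigO.fun_sum fun j hj => ?_
    simpa using (ha j (Nat.lt_succ_iff.1 (Finset.mem_range.1 hj))).mul (hρj j)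
  have hV : (fun x => ∑ j ∈ Finset.range (N + 1), b j x * ρ x ^ j) =O[l] G := by
    refine IsBigO.fun_sum fun j hj => ?_
    simpa using (hb j (Nat.lt_succ_iff.1 (Finset.mem_range.1 hj))).mul (hρj j)
  have hv' : v =O[l] G := by
    have h1 : (fun x => ρ x ^ N * G x) =O[l] G := by
      simpa using (hρj N).mul (isBigO_refl G l)
    simpa using (hv.isBigO.trans h1).add hV
  -- With `U`, `V` the truncations, `u v = (u - U) v + U (v - V) + U V`, and in `U V` only the terms
  -- of total degree above `N` have to be discarded.
  have e1 := hu.mul_isBigO hv'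
  have e2 : (fun x => (∑ j ∈ Finset.range (N + 1), a j x * ρ x ^ j) *
      (v x - ∑ j ∈ Finset.range (N + 1), b j x * ρ x ^ j)) =o[l] fun x => ρ x ^ N * G x := by
    simpa using hU.mul_isLittleO hv
  have hsmall : ∀ n, N < n → (fun x => ρ x ^ n) =o[l] fun x => ρ x ^ N := by
    intro n hn
    obtain ⟨k, rfl⟩ := Nat.exists_eq_add_of_lt hn
    have h1 : (fun x => ρ x ^ (k + 1)) =o[l] fun _ => (1 : ℝ) := by
      rw [isLittleO_one_iff]
      simpa using hρ.pow (k + 1)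
    simpa [← pow_add, add_assoc] using (isBigO_refl (fun x => ρ x ^ N) l).mul_isLittleO h1
  have e3 : (fun x => ∑ p ∈ (Finset.range (N + 1) ×ˢ Finset.range (N + 1)).filter
        (fun p => N < p.1 + p.2), a p.1 x * b p.2 x * ρ x ^ (p.1 + p.2))
      =o[l] fun x => ρ x ^ N * G x := by
    refine IsLittleO.fun_sum fun p hp => ?_
    simp only [Finset.mem_filter, Finset.mem_product, Finset.mem_range, Nat.lt_succ_iff] at hp
    simpa [mul_comm] using
      ((ha _ hp.1.1).mul (hb _ hp.1.2)).mul_isLittleO (hsmall _ hp.2)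
  refine ((e1.add e2).add e3).congr_left fun x => ?_
  have key : (∑ j ∈ Finset.range (N + 1), a j x * ρ x ^ j) *
      (∑ j ∈ Finset.range (N + 1), b j x * ρ x ^ j) =
      ∑ j ∈ Finset.range (N + 1),
        (∑ p ∈ Finset.HasAntidiagonal.antidiagonal j, a p.1 x * b p.2 x) * ρ x ^ j +
      ∑ p ∈ (Finset.range (N + 1) ×ˢ Finset.range (N + 1)).filter
        (fun p => N < p.1 + p.2), a p.1 x * b p.2 x * ρ x ^ (p.1 + p.2) := by
    rw [Finset.sum_mul_sum, ← Finset.sum_product',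
      ← Finset.sum_filter_not_add_sum_filter _ (fun p : ℕ × ℕ => N < p.1 + p.2)]
    congr 1
    · simp only [Finset.sum_mul]
      rw [Finset.sum_sigma']
      refine Finset.sum_bij' (fun p _ => ⟨p.1 + p.2, p⟩) (fun q _ => q.2) ?_ ?_ ?_ ?_ ?_
      · intro p hp
        simp at hp ⊢
        omega
      · rintro ⟨j, p⟩ hp
        simp at hp ⊢
        omega
      · intro p hp
        rfl
      · rintro ⟨j, p⟩ hp
        simp at hp
        simp [hp.2]
      · intro p hp
        simp only [pow_add]
        ring
    · refine Finset.sum_congr rfl fun p _ => ?_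
      rw [pow_add]
      ring
  linear_combination -key

theorem orderedProductSum_isBigO_one {a : ℕ → X → ℝ} (ha : ∀ j ≤ N, a j =O[l] fun _ => (1 : ℝ))
    (r m : ℕ) (hm : m ≤ N) :
    (fun x => orderedProductSum (fun n => a n x) m r) =O[l] fun _ => (1 : ℝ) := by
  induction r generalizing m with
  | zero =>
    simp only [orderedProductSum_zero]
    exact isBigO_const_const _ one_ne_zero _
  | succ r ih =>
    simp only [orderedProductSum_succ]
    refine IsBigO.fun_sum fun p hp => ?_
    have hp' := Finset.HasAntidiagonal.mem_antidiagonal.1 hp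
    have h1 : (fun x => if p.1 = 0 then 0 else a p.1 x) =O[l] fun _ => (1 : ℝ) := by
      split_ifs
      · exact isBigO_zero _ _
      · exact ha _ (by omega)
    simpa using h1.mul (ih p.2 (by omega))

theorem expansion_pow (hρ : Tendsto ρ l (𝓝 0)) {a : ℕ → X → ℝ} {u : X → ℝ}
    (ha : ∀ j ≤ N, a j =O[l] fun _ => (1 : ℝ))
    (hu : (fun x => u x - ∑ j ∈ Finset.range (N + 1), (if j = 0 then 0 else a j x) * ρ x ^ j)
      =o[l] fun x => ρ x ^ N) (r : ℕ) :
    (fun x => u x ^ r - ∑ j ∈ Finset.range (N + 1),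
      orderedProductSum (fun n => a n x) j r * ρ x ^ j) =o[l] fun x => ρ x ^ N := by
  induction r with
  | zero =>
    simp only [orderedProductSum_zero]
    simp
  | succ r ih =>
    have h := expansion_mul (G := fun _ => 1)
      (a := fun j x => if j = 0 then 0 else a j x) hρ (fun j hj => ?_)
      (fun j hj => orderedProductSum_isBigO_one ha r j hj) hu (by simpa using ih)
    · simpa [orderedProductSum_succ, pow_succ'] using h
    · by_cases h : j = 0
      · simpa [h] using isBigO_zero (E' := ℝ) (fun _ : X => (1 : ℝ)) l
      · simpa [h] using ha j hj

/-- The coefficient of `ρ ^ j` in `(∑_{n ≥ 1} a_n ρ ^ n) ^ r * ∑_n b_n ρ ^ n`. -/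
noncomputable def powMulCoeff (a b : ℕ → ℝ) (r j : ℕ) : ℝ :=
  ∑ p ∈ Finset.HasAntidiagonal.antidiagonal j, orderedProductSum a p.1 r * b p.2

theorem expansion_pow_mul (hρ : Tendsto ρ l (𝓝 0)) {a b : ℕ → X → ℝ} {u v G : X → ℝ}
    (ha : ∀ j ≤ N, a j =O[l] fun _ => (1 : ℝ)) (hb : ∀ j ≤ N, b j =O[l] G)
    (hu : (fun x => u x - ∑ j ∈ Finset.range (N + 1), (if j = 0 then 0 else a j x) * ρ x ^ j)
      =o[l] fun x => ρ x ^ N)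
    (hv : (fun x => v x - ∑ j ∈ Finset.range (N + 1), b j x * ρ x ^ j)
      =o[l] fun x => ρ x ^ N * G x) (r : ℕ) :
    (fun x => u x ^ r * v x - ∑ j ∈ Finset.range (N + 1),
      powMulCoeff (fun n => a n x) (fun n => b n x) r j * ρ x ^ j)
      =o[l] fun x => ρ x ^ N * G x := by
  unfold powMulCoeff
  exact expansion_mul (a := fun m x => orderedProductSum (fun n => a n x) m r) hρ
    (fun j hj => orderedProductSum_isBigO_one ha r j hj) hb (expansion_pow hρ ha hu r) hv

/-- A single term of the exponential series is at most the whole; this lets exponential decay absorb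
powers of `s`. -/
theorem pow_le_const_mul_exp {c : ℝ} (hc : 0 < c) (n : ℕ) {s : ℝ} (hs : 0 ≤ s) :
    s ^ n ≤ (n.factorial / c ^ n) * Real.exp (c * s) := by
  have h := Real.pow_div_factorial_le_exp (c * s) (by positivity) n
  have h1 : (0 : ℝ) < n.factorial := by positivity
  rw [div_le_iff₀ h1, mul_pow] at h
  rw [div_mul_eq_mul_div, le_div_iff₀ (by positivity)]
  linarith

theorem abs_exp_sub_sum_le (x : ℝ) (n : ℕ) :
    |Real.exp x - ∑ r ∈ Finset.range n, x ^ r / r.factorial| ≤ |x| ^ n * Real.exp |x| := by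
  have h := Complex.norm_exp_sub_sum_le_norm_mul_exp (x : ℂ) n
  have e : Complex.exp (x : ℂ) - ∑ r ∈ Finset.range n, (x : ℂ) ^ r / r.factorial =
      ((Real.exp x - ∑ r ∈ Finset.range n, x ^ r / r.factorial : ℝ) : ℂ) := by
    push_cast
    rfl
  rw [e] at h
  simpa only [Complex.norm_real, Real.norm_eq_abs] using h

/-- Expansion of `exp (-s (c + u)) v` for `u = ∑_{n ≥ 1} a_n ρ ^ n + o(ρ ^ N)` and
`v = ∑ b_n ρ ^ n + o(ρ ^ N G)`, with an error that is controlled for every `s ≥ 0`. -/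
theorem expansion_exp_mul (hρ : Tendsto ρ l (𝓝 0)) {a b : ℕ → X → ℝ}
    {u v G s : X → ℝ} {c : ℝ} (hc : 0 < c) (hs : ∀ᶠ x in l, 0 ≤ s x)
    (ha : ∀ j ≤ N, a j =O[l] fun _ => (1 : ℝ)) (hb : ∀ j ≤ N, b j =O[l] G)
    (hN : 0 < N)
    (hu : (fun x => u x - ∑ j ∈ Finset.range (N + 1), (if j = 0 then 0 else a j x) * ρ x ^ j)
      =o[l] fun x => ρ x ^ N)
    (hv : (fun x => v x - ∑ j ∈ Finset.range (N + 1), b j x * ρ x ^ j)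
      =o[l] fun x => ρ x ^ N * G x) :
    (fun x => Real.exp (-s x * (c + u x)) * v x - ∑ r ∈ Finset.range (N + 1),
      ∑ j ∈ Finset.range (N + 1), (-s x) ^ r / r.factorial *
        powMulCoeff (fun n => a n x) (fun n => b n x) r j * ρ x ^ j * Real.exp (-s x * c))
      =o[l] fun x => ρ x ^ N * G x * Real.exp (-s x * (c / 4)) := by
  have hρ1 : ρ =O[l] fun _ => (1 : ℝ) := hρ.isBigO_one ℝ
  have hρj : ∀ j, (fun x => ρ x ^ j) =O[l] fun _ => (1 : ℝ) := fun j => by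
    simpa using hρ1.pow j
  have hρj1 : ∀ j, 0 < j → (fun x => ρ x ^ j) =O[l] ρ := fun j hj => by
    obtain ⟨k, rfl⟩ := Nat.exists_eq_succ_of_ne_zero hj.ne'
    simpa [pow_succ'] using (isBigO_refl ρ l).mul (hρj k)
  have huρ : u =O[l] ρ := by
    have h2 : (fun x => ∑ j ∈ Finset.range (N + 1), (if j = 0 then 0 else a j x) * ρ x ^ j)
        =O[l] ρ := by
      refine IsBigO.fun_sum fun j hj => ?_
      by_cases h : j = 0
      · simpa [h] using isBigO_zero _ _
      · simpa [h] using (ha j (Nat.lt_succ_iff.1 (Finset.mem_range.1 hj))).mul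
          (hρj1 j (Nat.pos_of_ne_zero h))
    simpa using (hu.isBigO.trans (hρj1 N hN)).add h2
  have hu0 : Tendsto u l (𝓝 0) := huρ.trans_tendsto hρ
  have hvG : v =O[l] G := by
    have h1 : (fun x => ρ x ^ N * G x) =O[l] G := by
      simpa using (hρj N).mul (isBigO_refl G l)
    have hV : (fun x => ∑ j ∈ Finset.range (N + 1), b j x * ρ x ^ j) =O[l] G := by
      refine IsBigO.fun_sum fun j hj => ?_
      simpa using (hb j (Nat.lt_succ_iff.1 (Finset.mem_range.1 hj))).mul (hρj j)
    simpa using (hv.isBigO.trans h1).add hV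
  -- Half of the decay rate `c` absorbs any power of `s`, uniformly in `s ≥ 0`.
  have hexp : ∀ r : ℕ, (fun x => s x ^ r * Real.exp (-s x * c)) =O[l]
      fun x => Real.exp (-s x * (c / 2)) := by
    intro r
    refine IsBigO.of_bound (r.factorial / (c / 2) ^ r) ?_
    filter_upwards [hs] with x hx
    rw [Real.norm_of_nonneg (by positivity), Real.norm_of_nonneg (by positivity)]
    calc s x ^ r * Real.exp (-s x * c)
        ≤ (r.factorial / (c / 2) ^ r * Real.exp (c / 2 * s x)) * Real.exp (-s x * c) := by
          gcongr
          exact pow_le_const_mul_exp (by positivity) r hx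
      _ = _ := by
          rw [mul_assoc, ← Real.exp_add]
          ring_nf
  have hexp4 : (fun x => Real.exp (-s x * (c / 2))) =O[l]
      fun x => Real.exp (-s x * (c / 4)) := by
    refine IsBigO.of_bound 1 ?_
    filter_upwards [hs] with x hx
    rw [Real.norm_of_nonneg (by positivity), Real.norm_of_nonneg (by positivity), one_mul]
    apply Real.exp_le_exp.2
    nlinarith
  have hrem : (fun x => (Real.exp (-s x * u x) - ∑ r ∈ Finset.range (N + 1),
      (-s x * u x) ^ r / r.factorial) * Real.exp (-s x * c)) =O[l]
      fun x => ρ x ^ (N + 1) * Real.exp (-s x * (c / 4)) := by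
    have h1 : (fun x => (Real.exp (-s x * u x) - ∑ r ∈ Finset.range (N + 1),
        (-s x * u x) ^ r / r.factorial) * Real.exp (-s x * c)) =O[l]
        fun x => u x ^ (N + 1) * ((s x ^ (N + 1) * Real.exp (-s x * c)) *
          Real.exp (s x * (c / 4))) := by
      refine IsBigO.of_bound 1 ?_
      -- Since `u → 0`, the growth `exp (s |u|)` costs at most `c/4`; from the rate `c/2` left after
      -- absorbing `s^(N+1)`, the rate `c/4` survives.
      have hc4 : ∀ᶠ x in l, |u x| < c / 4 := by
        have := hu0.abs
        rw [abs_zero] at this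
        exact this.eventually_lt_const (by positivity)
      filter_upwards [hs, hc4] with x hx hux
      rw [norm_mul, one_mul, norm_mul, norm_mul, norm_mul, Real.norm_eq_abs,
        Real.norm_of_nonneg (Real.exp_pos (-s x * c)).le, Real.norm_of_nonneg (pow_nonneg hx _),
        Real.norm_of_nonneg (Real.exp_pos _).le]
      calc _ ≤ (|-s x * u x| ^ (N + 1) * Real.exp |-s x * u x|) * Real.exp (-s x * c) := by
            gcongr
            exact abs_exp_sub_sum_le _ _
        _ ≤ (|-s x * u x| ^ (N + 1) * Real.exp (s x * (c / 4))) * Real.exp (-s x * c) := by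
            gcongr
            rw [abs_mul, abs_neg, abs_of_nonneg hx]
            gcongr
        _ = _ := by
            rw [abs_mul, abs_neg, abs_of_nonneg hx, mul_pow, norm_pow, Real.norm_eq_abs]
            ring
    refine h1.trans ((huρ.pow (N + 1)).mul ?_)
    refine ((hexp (N + 1)).mul (isBigO_refl (fun x => Real.exp (s x * (c / 4))) l)).congr_right ?_
    intro x
    rw [← Real.exp_add]
    ring_nf
  have hρN : (fun x => ρ x ^ (N + 1)) =o[l] fun x => ρ x ^ N := by
    have h1 : ρ =o[l] fun _ => (1 : ℝ) := by rwa [isLittleO_one_iff]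
    simpa [pow_succ] using (isBigO_refl (fun x => ρ x ^ N) l).mul_isLittleO h1
  have e1 : (fun x => (Real.exp (-s x * u x) - ∑ r ∈ Finset.range (N + 1),
      (-s x * u x) ^ r / r.factorial) * Real.exp (-s x * c) * v x) =o[l]
      fun x => ρ x ^ N * G x * Real.exp (-s x * (c / 4)) := by
    refine (hrem.mul hvG).trans_isLittleO ?_
    refine ((hρN.mul_isBigO (isBigO_refl
      (fun x => G x * Real.exp (-s x * (c / 4))) l))).congr ?_ ?_
    · intro x; ring
    · intro x; ring
  have e2 : (fun x => ∑ r ∈ Finset.range (N + 1), ((-1) ^ r / r.factorial *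
      ((s x ^ r * Real.exp (-s x * c)) * (u x ^ r * v x - ∑ j ∈ Finset.range (N + 1),
      powMulCoeff (fun n => a n x) (fun n => b n x) r j * ρ x ^ j)))) =o[l]
      fun x => ρ x ^ N * G x * Real.exp (-s x * (c / 4)) := by
    refine IsLittleO.fun_sum fun r _ => ?_
    refine IsLittleO.const_mul_left ?_ _
    refine (((hexp r).trans hexp4).mul_isLittleO
      (expansion_pow_mul hρ ha hb hu hv r)).congr_right ?_
    intro x; ring
  refine (e1.add e2).congr_left fun x => ?_
  have h1 : Real.exp (-s x * (c + u x)) = Real.exp (-s x * u x) * Real.exp (-s x * c) := by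
    rw [← Real.exp_add]
    ring_nf
  simp only [h1, sub_mul, mul_sub, Finset.sum_sub_distrib, Finset.sum_mul, Finset.mul_sum]
  have h2 : ∑ r ∈ Finset.range (N + 1), (-s x * u x) ^ r / r.factorial *
      Real.exp (-s x * c) * v x = ∑ r ∈ Finset.range (N + 1), (-1) ^ r / r.factorial *
      (s x ^ r * Real.exp (-s x * c) * (u x ^ r * v x)) := by
    refine Finset.sum_congr rfl fun r _ => ?_
    rw [neg_mul, neg_pow, mul_pow]
    ring
  rw [h2]
  have h3 : ∑ r ∈ Finset.range (N + 1), ∑ j ∈ Finset.range (N + 1), (-1) ^ r / r.factorial *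
      (s x ^ r * Real.exp (-s x * c) *
        (powMulCoeff (fun n => a n x) (fun n => b n x) r j * ρ x ^ j)) =
      ∑ r ∈ Finset.range (N + 1), ∑ j ∈ Finset.range (N + 1), (-s x) ^ r / r.factorial *
        powMulCoeff (fun n => a n x) (fun n => b n x) r j * ρ x ^ j * Real.exp (-s x * c) := by
    refine Finset.sum_congr rfl fun r _ => Finset.sum_congr rfl fun j _ => ?_
    rw [neg_pow (s x)]
    ring
  rw [h3]
  ring

end Expansion

/-! ### Polar coordinates and radial Gamma integrals -/

/-- The measure `ρ ^ (d - 1) dρ dΩ` on `S^{d-1} × (0, ∞)`. -/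
noncomputable abbrev polarMeasure (d : ℕ) : Measure (UnitSphere d × Set.Ioi (0 : ℝ)) :=
  (sphereMeasure d).prod (Measure.volumeIoiPow (d - 1))

theorem norm_polar {d : ℕ} (p : UnitSphere d × Set.Ioi (0 : ℝ)) :
    ‖(p.2 : ℝ) • (p.1 : EuclideanSpace ℝ (Fin d))‖ = p.2 := by
  have h : ‖(p.1 : EuclideanSpace ℝ (Fin d))‖ = 1 := by simp
  rw [norm_smul, h, mul_one, Real.norm_of_nonneg (le_of_lt p.2.2)]

theorem polar_smul {d : ℕ} (x : ({0}ᶜ : Set (EuclideanSpace ℝ (Fin d)))) :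
    ((homeomorphUnitSphereProd _ x).2 : ℝ) •
      ((homeomorphUnitSphereProd _ x).1 : EuclideanSpace ℝ (Fin d)) = x := by
  have hx : ‖(x : EuclideanSpace ℝ (Fin d))‖ ≠ 0 := norm_ne_zero_iff.2 x.2
  simp [smul_smul, hx]

/-- The polar homeomorphism of the punctured space is measure preserving, and the origin is a null
set because `d > 0`. -/
theorem integrable_polar_iff {d : ℕ} (hd : 0 < d) (F : EuclideanSpace ℝ (Fin d) → ℝ) :
    Integrable (fun p : UnitSphere d × Set.Ioi (0 : ℝ) =>
      F ((p.2 : ℝ) • (p.1 : EuclideanSpace ℝ (Fin d)))) (polarMeasure d) ↔ Integrable F := by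
  have : Nonempty (Fin d) := ⟨⟨0, hd⟩⟩
  have h := (volume : Measure (EuclideanSpace ℝ (Fin d))).measurePreserving_homeomorphUnitSphereProd
    |>.integrable_comp_emb (g := fun p => F ((p.2 : ℝ) • (p.1 : EuclideanSpace ℝ (Fin d))))
    (Homeomorph.measurableEmbedding _)
  rw [finrank_euclideanSpace_fin] at h
  rw [← h]
  simp only [Function.comp_def, polar_smul]
  conv_rhs => rw [← restrict_compl_singleton (μ := volume) (0 : EuclideanSpace ℝ (Fin d)),
    ← IntegrableOn, integrableOn_iff_comap_subtypeVal (measurableSet_singleton _).compl]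
  rfl

theorem integral_polar {d : ℕ} (hd : 0 < d) (F : EuclideanSpace ℝ (Fin d) → ℝ) :
    ∫ p : UnitSphere d × Set.Ioi (0 : ℝ),
      F ((p.2 : ℝ) • (p.1 : EuclideanSpace ℝ (Fin d))) ∂(polarMeasure d) = ∫ x, F x := by
  have : Nonempty (Fin d) := ⟨⟨0, hd⟩⟩
  have h := (volume : Measure (EuclideanSpace ℝ (Fin d))).measurePreserving_homeomorphUnitSphereProd
    |>.integral_comp
    (Homeomorph.measurableEmbedding _) (fun p => F ((p.2 : ℝ) • (p.1 : EuclideanSpace ℝ (Fin d))))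
  rw [finrank_euclideanSpace_fin] at h
  rw [← h]
  simp only [polar_smul]
  rw [integral_subtype_comap (measurableSet_singleton _).compl, restrict_compl_singleton]

/-- The polar coordinate image of the ball of radius `δ`. -/
def polarBall (d : ℕ) (δ : ℝ) : Set (UnitSphere d × Set.Ioi (0 : ℝ)) := {p | (p.2 : ℝ) < δ}

theorem measurableSet_polarBall (d : ℕ) (δ : ℝ) : MeasurableSet (polarBall d δ) :=
  measurableSet_lt (measurable_subtype_coe.comp measurable_snd) measurable_const

theorem indicator_polarBall {d : ℕ} (δ : ℝ) (F : EuclideanSpace ℝ (Fin d) → ℝ) :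
    (polarBall d δ).indicator (fun p : UnitSphere d × Set.Ioi (0 : ℝ) =>
      F ((p.2 : ℝ) • (p.1 : EuclideanSpace ℝ (Fin d)))) =
    fun p => (Metric.ball 0 δ).indicator F ((p.2 : ℝ) • (p.1 : EuclideanSpace ℝ (Fin d))) := by
  funext p
  have : p ∈ polarBall d δ ↔
      (p.2 : ℝ) • (p.1 : EuclideanSpace ℝ (Fin d)) ∈ Metric.ball 0 δ := by
    rw [mem_ball_zero_iff, norm_polar]
    rfl
  by_cases h : p ∈ polarBall d δ
  · rw [Set.indicator_of_mem h, Set.indicator_of_mem (this.1 h)]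
  · rw [Set.indicator_of_notMem h, Set.indicator_of_notMem (fun h' => h (this.2 h'))]

theorem integrableOn_polarBall_iff {d : ℕ} (hd : 0 < d) (δ : ℝ)
    (F : EuclideanSpace ℝ (Fin d) → ℝ) :
    IntegrableOn (fun p : UnitSphere d × Set.Ioi (0 : ℝ) =>
      F ((p.2 : ℝ) • (p.1 : EuclideanSpace ℝ (Fin d)))) (polarBall d δ) (polarMeasure d) ↔
    IntegrableOn F (Metric.ball 0 δ) := by
  rw [← integrable_indicator_iff (measurableSet_polarBall d δ), indicator_polarBall,
    integrable_polar_iff hd, integrable_indicator_iff measurableSet_ball]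

theorem setIntegral_polarBall {d : ℕ} (hd : 0 < d) (δ : ℝ)
    (F : EuclideanSpace ℝ (Fin d) → ℝ) :
    ∫ p in polarBall d δ, F ((p.2 : ℝ) • (p.1 : EuclideanSpace ℝ (Fin d))) ∂(polarMeasure d) =
    ∫ x in Metric.ball 0 δ, F x := by
  rw [← integral_indicator (measurableSet_polarBall d δ), indicator_polarBall,
    integral_polar hd, integral_indicator measurableSet_ball]

theorem integral_volumeIoiPow (n : ℕ) (ψ : ℝ → ℝ) :
    ∫ ρ : Set.Ioi (0 : ℝ), ψ ρ ∂(Measure.volumeIoiPow n) =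
      ∫ ρ in Set.Ioi (0 : ℝ), ρ ^ n * ψ ρ := by
  simp only [Measure.volumeIoiPow, ENNReal.ofReal]
  rw [integral_withDensity_eq_integral_smul,
    integral_subtype_comap measurableSet_Ioi fun a ↦ Real.toNNReal (a ^ n) • ψ a,
    setIntegral_congr_fun measurableSet_Ioi fun x hx ↦ ?_]
  · rw [NNReal.smul_def, Real.coe_toNNReal _ (pow_nonneg hx.out.le _), smul_eq_mul]
  · exact (measurable_subtype_coe.pow_const _).real_toNNReal

theorem integral_volumeIoiPow_rpow_mul_exp (n : ℕ) {ν q b : ℝ} (hν : 0 < ν) (hq : 0 < q)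
    (hb : 0 < b) :
    ∫ ρ : Set.Ioi (0 : ℝ), (ρ : ℝ) ^ (q - (n + 1)) * Real.exp (-b * (ρ : ℝ) ^ ν)
      ∂(Measure.volumeIoiPow n) = b ^ (-(q / ν)) * (1 / ν) * Real.Gamma (q / ν) := by
  rw [integral_volumeIoiPow n (fun ρ => ρ ^ (q - (n + 1)) * Real.exp (-b * ρ ^ ν))]
  have h := integral_rpow_mul_exp_neg_mul_rpow (p := ν) (q := q - 1) hν (by linarith) hb
  rw [sub_add_cancel, neg_div] at h
  rw [← h]
  refine setIntegral_congr_fun measurableSet_Ioi fun x hx => ?_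
  have hx : 0 < x := hx
  rw [← mul_assoc, ← Real.rpow_natCast, ← Real.rpow_add hx]
  ring_nf

theorem integrable_volumeIoiPow_rpow_mul_exp (n : ℕ) {ν q b : ℝ} (hν : 0 < ν) (hq : 0 < q)
    (hb : 0 < b) :
    Integrable (fun ρ : Set.Ioi (0 : ℝ) =>
      (ρ : ℝ) ^ (q - (n + 1)) * Real.exp (-b * (ρ : ℝ) ^ ν)) (Measure.volumeIoiPow n) := by
  -- The Bochner integral of a non-integrable function is `0` by convention, whereas the Gamma value
  -- is positive.
  refine Integrable.of_integral_ne_zero ?_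
  rw [integral_volumeIoiPow_rpow_mul_exp n hν hq hb]
  have := Real.Gamma_pos_of_pos (div_pos hq hν)
  positivity

/-! ### Exponentially small tails, and recovery of coefficients from an expansion -/

/-- A Laplace integral over a region where the phase is bounded below by a positive constant is
smaller than every power. -/
theorem isLittleO_integral_exp_neg_mul {X : Type*} [MeasurableSpace X] {μ : Measure X}
    {ψ h : X → ℝ} {A k₀ : ℝ} (hA : 0 < A) (hψ : ∀ᵐ x ∂μ, A ≤ ψ x)
    (hint : Integrable (fun x => Real.exp (-k₀ * ψ x) * h x) μ) (q : ℝ) :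
    (fun k : ℝ => ∫ x, Real.exp (-k * ψ x) * h x ∂μ) =o[atTop] fun k => k ^ q := by
  have hO : (fun k : ℝ => ∫ x, Real.exp (-k * ψ x) * h x ∂μ) =O[atTop]
      fun k => Real.exp (-A * k) := by
    -- Write `exp (-k ψ) = exp (-(k - k₀) ψ) exp (-k₀ ψ)` and bound the first factor by `exp (-A (k
    -- - k₀))`; this is where `exp (k₀ A)` comes from.
    refine IsBigO.of_bound (Real.exp (k₀ * A) * ∫ x, ‖Real.exp (-k₀ * ψ x) * h x‖ ∂μ) ?_
    filter_upwards [eventually_ge_atTop k₀] with k hk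
    rw [Real.norm_of_nonneg (Real.exp_pos (-A * k)).le]
    calc ‖∫ x, Real.exp (-k * ψ x) * h x ∂μ‖
        ≤ ∫ x, Real.exp (-A * (k - k₀)) * ‖Real.exp (-k₀ * ψ x) * h x‖ ∂μ := by
          refine norm_integral_le_of_norm_le (hint.norm.const_mul _) ?_
          filter_upwards [hψ] with x hx
          rw [norm_mul, norm_mul, ← mul_assoc, Real.norm_of_nonneg (Real.exp_pos _).le,
            Real.norm_of_nonneg (Real.exp_pos _).le, ← Real.exp_add]
          gcongr
          nlinarith
      _ = _ := by
          rw [integral_const_mul, mul_right_comm, ← Real.exp_add]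
          ring_nf
  exact hO.trans_isLittleO (isLittleO_exp_neg_mul_rpow_atTop hA q)

/-- If `∑ c_j ρ ^ j` is integrable for more than `N` values of `ρ`, then every `c_j` is. -/
theorem integrable_coeff_of_integrable_sum {S : Type*} [MeasurableSpace S] {σ : Measure S} {N : ℕ}
    {c : ℕ → S → ℝ} {t : Fin (N + 1) → ℝ} (ht : Function.Injective t)
    (h : ∀ i, Integrable (fun Ω => ∑ j ∈ Finset.range (N + 1), c j Ω * t i ^ j) σ)
    {j : ℕ} (hj : j ≤ N) : Integrable (c j) σ := by
  -- Distinct nodes make the Vandermonde matrix invertible, so each `c j` is a fixed linear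
  -- combination of the given integrable sums.
  have hdet : IsUnit (Matrix.vandermonde t).det :=
    (Matrix.det_vandermonde_ne_zero_iff.2 ht).isUnit
  have key : ∀ Ω, c j Ω = ∑ i, (Matrix.vandermonde t)⁻¹ ⟨j, Nat.lt_succ_of_le hj⟩ i *
      ∑ j ∈ Finset.range (N + 1), c j Ω * t i ^ j := by
    intro Ω
    have e : (Matrix.vandermonde t).mulVec (fun j : Fin (N + 1) => c j Ω) =
        fun i => ∑ j ∈ Finset.range (N + 1), c j Ω * t i ^ j := by
      funext i
      rw [← Fin.sum_univ_eq_sum_range (fun j => c j Ω * t i ^ j)]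
      simp [Matrix.mulVec, dotProduct, Matrix.vandermonde_apply, mul_comm]
    have e2 := congrArg (fun v => (Matrix.vandermonde t)⁻¹.mulVec v ⟨j, Nat.lt_succ_of_le hj⟩) e
    simp only [Matrix.mulVec_mulVec, Matrix.nonsing_inv_mul _ hdet, Matrix.one_mulVec] at e2
    rw [e2]
    rfl
  rw [show c j = _ from funext key]
  exact integrable_finsetSum _ fun i _ => (h i).const_mul _

/-- The coefficients of a uniform expansion are a.e. measurable as soon as the expanded function is
so for arbitrarily small `ρ`. -/
theorem aestronglyMeasurable_coeff {S : Type*} [MeasurableSpace S] {σ : Measure S} {N : ℕ}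
    {c : ℕ → S → ℝ} {v : ℝ → S → ℝ}
    (hv : ∀ Ω, (fun ρ => v ρ Ω - ∑ j ∈ Finset.range (N + 1), c j Ω * ρ ^ j)
      =o[𝓝[>] (0 : ℝ)] fun ρ => ρ ^ N)
    (hfreq : ∃ᶠ ρ in 𝓝[>] (0 : ℝ), AEStronglyMeasurable (v ρ) σ) (j : ℕ) (hj : j ≤ N) :
    AEStronglyMeasurable (c j) σ := by
  induction j using Nat.strong_induction_on with
  | _ j ih =>
  obtain ⟨t, ht, hmeas⟩ := exists_seq_forall_of_frequently hfreq
  -- Along radii `t n → 0⁺` with measurable slices, `c j` is the pointwise limit of `ρ^(-j)` times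
  -- the slice minus its lower-order terms, which are measurable by induction.
  refine aestronglyMeasurable_of_tendsto_ae atTop
    (f := fun n Ω => ((t n) ^ j)⁻¹ * (v (t n) Ω - ∑ i ∈ Finset.range j, c i Ω * t n ^ i)) ?_ ?_
  · intro n
    refine AEStronglyMeasurable.const_mul ((hmeas n).sub ?_) _
    refine Finset.aestronglyMeasurable_fun_sum _ fun i hi => ?_
    have hi := Finset.mem_range.1 hi
    exact (ih i hi (by omega)).mul_const _
  · refine Eventually.of_forall fun Ω => ?_
    refine Tendsto.comp (g := fun ρ => (ρ ^ j)⁻¹ * (v ρ Ω - ∑ i ∈ Finset.range j, c i Ω * ρ ^ i))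
      ?_ ht
    have hρ0 : Tendsto (fun ρ : ℝ => ρ) (𝓝[>] 0) (𝓝 0) := tendsto_nhdsWithin_of_tendsto_nhds tendsto_id
    have h1 : Tendsto (fun ρ => (ρ ^ j)⁻¹ *
        (v ρ Ω - ∑ j ∈ Finset.range (N + 1), c j Ω * ρ ^ j)) (𝓝[>] 0) (𝓝 0) := by
      have hO : (fun ρ : ℝ => ρ ^ N) =O[𝓝[>] 0] fun ρ => ρ ^ j := by
        obtain ⟨m, rfl⟩ := Nat.exists_eq_add_of_le hj
        simpa [pow_add] using (isBigO_refl (fun ρ : ℝ => ρ ^ j) (𝓝[>] 0)).mul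
          ((hρ0.pow m).isBigO_one ℝ)
      have := ((hv Ω).trans_isBigO hO).tendsto_div_nhds_zero
      simpa [div_eq_inv_mul] using this
    have h2 : Tendsto (fun ρ : ℝ => ∑ i ∈ Finset.range (N + 1 - j), c (j + i) Ω * ρ ^ i)
        (𝓝[>] 0) (𝓝 (c j Ω)) := by
      have : Tendsto (fun ρ : ℝ => ∑ i ∈ Finset.range (N + 1 - j), c (j + i) Ω * ρ ^ i)
          (𝓝[>] 0) (𝓝 (∑ i ∈ Finset.range (N + 1 - j), c (j + i) Ω * 0 ^ i)) :=
        tendsto_finsetSum _ fun i _ => (hρ0.pow i).const_mul _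
      obtain ⟨m, hm⟩ : ∃ m, N + 1 - j = m + 1 := ⟨N - j, by omega⟩
      rw [hm] at this ⊢
      simpa [Finset.sum_range_succ'] using this
    have h3 := h1.add h2
    rw [zero_add] at h3
    refine h3.congr' ?_
    filter_upwards [self_mem_nhdsWithin] with ρ hρ
    have hρ : 0 < ρ := hρ
    have e : ∑ i ∈ Finset.range (N + 1), c i Ω * ρ ^ i = ∑ i ∈ Finset.range j, c i Ω * ρ ^ i +
        ρ ^ j * ∑ i ∈ Finset.range (N + 1 - j), c (j + i) Ω * ρ ^ i := by
      conv_lhs => rw [show N + 1 = j + (N + 1 - j) by omega]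
      rw [Finset.sum_range_add, Finset.mul_sum]
      congr 1
      refine Finset.sum_congr rfl fun i _ => ?_
      rw [pow_add]
      ring
    rw [e]
    field_simp
    ring

/-! ### Uniform radial expansions and the continuity criterion -/

theorem eventually_radial_iff {d : ℕ} {P : ℝ × UnitSphere d → Prop} :
    (∀ᶠ p in (𝓝[>] (0 : ℝ)) ×ˢ (⊤ : Filter (UnitSphere d)), P p) ↔
      ∀ᶠ ρ in 𝓝[>] (0 : ℝ), ∀ Ω, P (ρ, Ω) := by
  rw [← principal_univ, eventually_prod_principal_iff]
  simp

theorem tendsto_radial_fst {d : ℕ} :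
    Tendsto (fun p : ℝ × UnitSphere d => p.1) ((𝓝[>] (0 : ℝ)) ×ˢ (⊤ : Filter (UnitSphere d)))
      (𝓝 0) :=
  (tendsto_nhdsWithin_of_tendsto_nhds tendsto_id).comp tendsto_fst

theorem eventually_radial_pos {d : ℕ} :
    ∀ᶠ p in (𝓝[>] (0 : ℝ)) ×ˢ (⊤ : Filter (UnitSphere d)), 0 < p.1 :=
  eventually_radial_iff.2 (by filter_upwards [self_mem_nhdsWithin] with ρ hρ Ω using hρ)

theorem HasRadialExpansion.normalized {d : ℕ} {h : EuclideanSpace ℝ (Fin d) → ℝ} {s : ℝ} {N : ℕ}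
    {c : ℕ → UnitSphere d → ℝ} (hh : HasRadialExpansion h s N c) :
    (fun p : ℝ × UnitSphere d => p.1 ^ (-s) * h (p.1 • (p.2 : EuclideanSpace ℝ (Fin d)))
      - ∑ j ∈ Finset.range (N + 1), c j p.2 * p.1 ^ j)
      =o[(𝓝[>] (0 : ℝ)) ×ˢ (⊤ : Filter (UnitSphere d))] fun p => p.1 ^ N := by
  refine ((isBigO_refl (fun p : ℝ × UnitSphere d => p.1 ^ (-s)) _).mul_isLittleO hh).congr' ?_ ?_
  · filter_upwards [eventually_radial_pos] with p hp
    rw [mul_sub, ← mul_assoc, ← Real.rpow_add hp]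
    simp
  · filter_upwards [eventually_radial_pos] with p hp
    rw [← Real.rpow_add hp, ← Real.rpow_natCast]
    ring_nf

theorem isBigO_one_of_continuous {d : ℕ} {c : UnitSphere d → ℝ} (hc : Continuous c)
    (l : Filter (ℝ × UnitSphere d)) : (fun p => c p.2) =O[l] fun _ => (1 : ℝ) := by
  obtain ⟨C, hC⟩ := isCompact_univ.exists_bound_of_continuousOn hc.continuousOn
  exact IsBigO.of_bound C (Eventually.of_forall fun p => by simpa using hC p.2 trivial)

/-- The coefficients `fc j` with `j ≥ 1` are bounded, being continuous on a compact sphere, so their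
terms vanish uniformly in the direction. -/
theorem tendsto_radialQuotient_sub {d : ℕ} {f : EuclideanSpace ℝ (Fin d) → ℝ} {ν : ℝ} {N : ℕ}
    (hN : 0 < N) {fc : ℕ → UnitSphere d → ℝ} (hfc : ∀ j ≤ N, Continuous (fc j))
    (hfexp : HasRadialExpansion f ν N fc) :
    Tendsto (fun p : ℝ × UnitSphere d =>
      p.1 ^ (-ν) * f (p.1 • (p.2 : EuclideanSpace ℝ (Fin d))) - fc 0 p.2)
      ((𝓝[>] (0 : ℝ)) ×ˢ (⊤ : Filter (UnitSphere d))) (𝓝 0) := by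
  have h1 := hfexp.normalized.isBigO.trans_tendsto (by
    simpa [hN.ne'] using (tendsto_radial_fst (d := d)).pow N)
  have h2 : Tendsto (fun p : ℝ × UnitSphere d => ∑ j ∈ Finset.range N, fc (j + 1) p.2 * p.1 ^ (j + 1))
      ((𝓝[>] (0 : ℝ)) ×ˢ (⊤ : Filter (UnitSphere d))) (𝓝 0) := by
    have h0 : (0 : ℝ) = ∑ _j ∈ Finset.range N, (0 : ℝ) := by simp
    conv =>
      arg 3
      rw [h0]
    refine tendsto_finsetSum _ fun j hj => ?_
    have hb := (isBigO_one_of_continuous (hfc (j + 1) (Finset.mem_range.1 hj))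
      ((𝓝[>] (0 : ℝ)) ×ˢ (⊤ : Filter (UnitSphere d)))).mul
      (isBigO_refl (fun p : ℝ × UnitSphere d => p.1 ^ (j + 1)) _)
    refine hb.trans_tendsto ?_
    simpa using (tendsto_radial_fst (d := d)).pow (j + 1)
  have h3 := h1.add h2
  rw [add_zero] at h3
  refine h3.congr fun p => ?_
  rw [Finset.sum_range_succ']
  ring

theorem radialQuotientContinuousAtZero_iff {d : ℕ}
    {f : EuclideanSpace ℝ (Fin d) → ℝ} {ν : ℝ} {N : ℕ}
    (hN : 0 < N) {fc : ℕ → UnitSphere d → ℝ} (hfc : ∀ j ≤ N, Continuous (fc j))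
    (hfexp : HasRadialExpansion f ν N fc) :
    RadialQuotientContinuousAtZero f ν ↔ ∃ c : ℝ, ∀ Ω, fc 0 Ω = c := by
  have hlim := tendsto_radialQuotient_sub hN hfc hfexp
  constructor
  · rintro ⟨c, hc⟩
    refine ⟨c, fun Ω => ?_⟩
    -- Along the ray through `Ω` the quotient tends both to `c` and to `fc 0 Ω`.
    have hray : Tendsto (fun ρ : ℝ => ρ • (Ω : EuclideanSpace ℝ (Fin d))) (𝓝[>] 0) (𝓝[≠] 0) := by
      refine tendsto_nhdsWithin_iff.2 ⟨?_, ?_⟩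
      · have : Continuous fun ρ : ℝ => ρ • (Ω : EuclideanSpace ℝ (Fin d)) := by fun_prop
        simpa using (this.tendsto 0).mono_left nhdsWithin_le_nhds
      · filter_upwards [self_mem_nhdsWithin] with ρ hρ
        exact smul_ne_zero (ne_of_gt hρ) (ne_zero_of_mem_unit_sphere Ω)
    have h1 := hc.comp hray
    have h2 := hlim.comp (tendsto_id.prodMk (tendsto_top (f := fun _ : ℝ => Ω)))
    have h3 := h1.sub h2
    have h4 : Tendsto (fun _ : ℝ => fc 0 Ω) (𝓝[>] 0) (𝓝 (c - 0)) := by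
      refine h3.congr' ?_
      filter_upwards [self_mem_nhdsWithin] with ρ hρ
      have hρ : 0 < ρ := hρ
      simp [norm_smul, abs_of_pos hρ]
    rw [sub_zero] at h4
    exact tendsto_nhds_unique tendsto_const_nhds h4
  · rintro ⟨c, hc⟩
    refine ⟨c, ?_⟩
    rw [Metric.tendsto_nhds] at hlim ⊢
    intro ε hε
    have h1 := eventually_radial_iff.1 (hlim ε hε)
    have hnorm : Tendsto (fun x : EuclideanSpace ℝ (Fin d) => ‖x‖) (𝓝[≠] 0) (𝓝[>] 0) :=
      tendsto_norm_nhdsNE_zero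
    filter_upwards [hnorm.eventually h1, self_mem_nhdsWithin] with x hx hx0
    have hx0 : ‖x‖ ≠ 0 := norm_ne_zero_iff.2 hx0
    have := hx ⟨‖x‖⁻¹ • x, by simp [norm_smul, hx0]⟩
    simpa [smul_smul, hx0, hc, dist_eq_norm] using this

/-! ### The model integrand, its pointwise error and its integral -/

/-- The leading part of the Laplace integrand `exp (-k f) g` in polar coordinates. -/
noncomputable def laplaceMain {d : ℕ} (ν lam f₀ : ℝ) (N : ℕ) (fc gc : ℕ → UnitSphere d → ℝ) (k : ℝ)
    (p : UnitSphere d × Set.Ioi (0 : ℝ)) : ℝ :=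
  ∑ r ∈ Finset.range (N + 1), ∑ j ∈ Finset.range (N + 1), ((-k) ^ r / r.factorial) *
    (powMulCoeff (fun n => fc n p.1) (fun n => gc n p.1) r j *
      ((p.2 : ℝ) ^ (ν * r + j + lam - ((d - 1 : ℕ) + 1)) *
        Real.exp (-(k * f₀) * (p.2 : ℝ) ^ ν)))

/-- The radius `δ` is chosen before `k`, so this bound can be integrated for every `k`. The exponent
is written with `(d - 1 : ℕ) + 1` to match the radial density `ρ^(d-1)`. -/
theorem norm_laplace_sub_laplaceMain_le {d : ℕ} (hd : 0 < d) {f g : EuclideanSpace ℝ (Fin d) → ℝ}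
    {ν lam f₀ : ℝ} {N : ℕ} (hN : 0 < N) (hf₀ : 0 < f₀)
    {fc gc : ℕ → UnitSphere d → ℝ} (hfc : ∀ j ≤ N, Continuous (fc j)) (hconst : ∀ Ω, fc 0 Ω = f₀)
    (hfexp : HasRadialExpansion f ν N fc) (hgexp : HasRadialExpansion g (lam - d) N gc)
    {η : ℝ} (hη : 0 < η) :
    ∀ᶠ δ in 𝓝[>] (0 : ℝ), ∀ k : ℝ, 0 ≤ k → ∀ p ∈ polarBall d δ,
      ‖Real.exp (-k * f ((p.2 : ℝ) • (p.1 : EuclideanSpace ℝ (Fin d)))) *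
        g ((p.2 : ℝ) • (p.1 : EuclideanSpace ℝ (Fin d))) - laplaceMain ν lam f₀ N fc gc k p‖ ≤
      η * ((1 + ∑ j ∈ Finset.range (N + 1), |gc j p.1|) *
        ((p.2 : ℝ) ^ (N + lam - ((d - 1 : ℕ) + 1)) *
          Real.exp (-(k * (f₀ / 4)) * (p.2 : ℝ) ^ ν))) := by
  have hd1 : (((d - 1 : ℕ) : ℝ) + 1) = d := by
    rw [Nat.cast_pred hd]
    ring
  set l := (𝓝[>] (0 : ℝ)) ×ˢ (⊤ : Filter (UnitSphere d)) with hl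
  -- The principal factor carries `k ≥ 0` as a parameter, so that asymptotics along `l'` are uniform
  -- in `k` as well as in `Ω`.
  set l' : Filter ((ℝ × UnitSphere d) × ℝ) := l ×ˢ 𝓟 (Set.Ici 0) with hl'
  have ht : Tendsto Prod.fst l' l := tendsto_fst
  have hk : ∀ᶠ x in l', 0 ≤ x.2 :=
    tendsto_snd.eventually (mem_principal_self (Set.Ici (0 : ℝ)))
  have hpos : ∀ᶠ x in l', 0 < x.1.1 := ht.eventually eventually_radial_pos
  have hu : (fun x : (ℝ × UnitSphere d) × ℝ =>
      (x.1.1 ^ (-ν) * f (x.1.1 • (x.1.2 : EuclideanSpace ℝ (Fin d))) - f₀) -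
      ∑ j ∈ Finset.range (N + 1), (if j = 0 then 0 else fc j x.1.2) * x.1.1 ^ j)
      =o[l'] fun x => x.1.1 ^ N := by
    refine (hfexp.normalized.comp_tendsto ht).congr_left fun x => ?_
    simp only [Function.comp]
    rw [Finset.sum_range_succ', Finset.sum_range_succ']
    simp [hconst]
    ring
  -- The `gc j` may be unbounded, so errors are measured against `G = 1 + ∑ |gc j|`; the summand `1`
  -- lets `G` dominate the uniform error of `g`.
  have hGone : (fun x : (ℝ × UnitSphere d) × ℝ => x.1.1 ^ N) =O[l'] fun x => x.1.1 ^ N *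
      (1 + ∑ j ∈ Finset.range (N + 1), |gc j x.1.2|) := by
    refine IsBigO.of_bound 1 (Eventually.of_forall fun x => ?_)
    have : 0 ≤ ∑ j ∈ Finset.range (N + 1), |gc j x.1.2| :=
      Finset.sum_nonneg fun _ _ => abs_nonneg _
    rw [norm_mul, Real.norm_of_nonneg (by positivity :
      0 ≤ 1 + ∑ j ∈ Finset.range (N + 1), |gc j x.1.2|), one_mul]
    nlinarith [norm_nonneg (x.1.1 ^ N)]
  have hv : (fun x : (ℝ × UnitSphere d) × ℝ =>
      x.1.1 ^ (-(lam - d)) * g (x.1.1 • (x.1.2 : EuclideanSpace ℝ (Fin d))) -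
      ∑ j ∈ Finset.range (N + 1), gc j x.1.2 * x.1.1 ^ j)
      =o[l'] fun x => x.1.1 ^ N * (1 + ∑ j ∈ Finset.range (N + 1), |gc j x.1.2|) :=
    (hgexp.normalized.comp_tendsto ht).trans_isBigO hGone
  have hb : ∀ j ≤ N, (fun x : (ℝ × UnitSphere d) × ℝ => gc j x.1.2) =O[l']
      fun x => 1 + ∑ j ∈ Finset.range (N + 1), |gc j x.1.2| := by
    intro j hj
    refine IsBigO.of_bound 1 (Eventually.of_forall fun x => ?_)
    have h1 : |gc j x.1.2| ≤ ∑ j ∈ Finset.range (N + 1), |gc j x.1.2| :=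
      Finset.single_le_sum (f := fun j => |gc j x.1.2|) (fun _ _ => abs_nonneg _)
        (Finset.mem_range.2 (Nat.lt_succ_of_le hj))
    have h0 := abs_nonneg (gc j x.1.2)
    rw [Real.norm_eq_abs, Real.norm_of_nonneg (by linarith), one_mul]
    linarith
  -- The substitution `s = k ρ^ν` turns `exp (-k f)` into `exp (-s (f₀ + u))`.
  have hcore := expansion_exp_mul (l := l') (ρ := fun x => x.1.1) (s := fun x => x.2 * x.1.1 ^ ν)
    (a := fun j x => fc j x.1.2) (b := fun j x => gc j x.1.2)
    (tendsto_radial_fst.comp ht) hf₀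
    (by filter_upwards [hk, hpos] with x h1 h2 using mul_nonneg h1 (Real.rpow_nonneg h2.le _))
    (fun j hj => (isBigO_one_of_continuous (hfc j hj) l).comp_tendsto ht) hb hN hu hv
  have hev := eventually_prod_principal_iff.1 ((isLittleO_iff.1 hcore) hη)
  obtain ⟨δ₀, hδ₀, hδ⟩ := mem_nhdsGT_iff_exists_Ioo_subset.1 (eventually_radial_iff.1 hev)
  filter_upwards [Ioo_mem_nhdsGT hδ₀] with δ hδ1 k hk p hp
  have hp2 : (p.2 : ℝ) < δ := hp
  have hρ : 0 < (p.2 : ℝ) := p.2.2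
  have key := hδ ⟨hρ, hp2.trans hδ1.2⟩ p.1 k hk
  simp only at key
  set ρ : ℝ := (p.2 : ℝ) with hρdef
  set G : ℝ := 1 + ∑ j ∈ Finset.range (N + 1), |gc j p.1| with hGdef
  have hG : 0 ≤ G := by
    have : 0 ≤ ∑ j ∈ Finset.range (N + 1), |gc j p.1| :=
      Finset.sum_nonneg fun _ _ => abs_nonneg _
    positivity
  have hA : Real.exp (-k * f (ρ • (p.1 : EuclideanSpace ℝ (Fin d)))) *
      g (ρ • (p.1 : EuclideanSpace ℝ (Fin d))) = ρ ^ (lam - d) *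
      (Real.exp (-(k * ρ ^ ν) *
        (f₀ + (ρ ^ (-ν) * f (ρ • (p.1 : EuclideanSpace ℝ (Fin d))) - f₀))) *
        (ρ ^ (-(lam - d)) * g (ρ • (p.1 : EuclideanSpace ℝ (Fin d))))) := by
    have h1 : ρ ^ ν * ρ ^ (-ν) = 1 := by rw [← Real.rpow_add hρ]; simp
    have h2 : ρ ^ (lam - d) * ρ ^ (-(lam - d)) = 1 := by rw [← Real.rpow_add hρ]; simp
    have h3 : -(k * ρ ^ ν) *
        (f₀ + (ρ ^ (-ν) * f (ρ • (p.1 : EuclideanSpace ℝ (Fin d))) - f₀)) =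
        -k * f (ρ • (p.1 : EuclideanSpace ℝ (Fin d))) := by
      linear_combination (-k * f (ρ • (p.1 : EuclideanSpace ℝ (Fin d)))) * h1
    rw [h3]
    linear_combination (-Real.exp (-k * f (ρ • (p.1 : EuclideanSpace ℝ (Fin d)))) *
      g (ρ • (p.1 : EuclideanSpace ℝ (Fin d)))) * h2
  have hM : laplaceMain ν lam f₀ N fc gc k p = ρ ^ (lam - d) *
      ∑ r ∈ Finset.range (N + 1), ∑ j ∈ Finset.range (N + 1),
        (-(k * ρ ^ ν)) ^ r / r.factorial * powMulCoeff (fun n => fc n p.1) (fun n => gc n p.1) r j *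
          ρ ^ j * Real.exp (-(k * ρ ^ ν) * f₀) := by
    unfold laplaceMain
    simp only [Finset.mul_sum]
    refine Finset.sum_congr rfl fun r _ => Finset.sum_congr rfl fun j _ => ?_
    have h1 : ρ ^ (ν * r + j + lam - ((d - 1 : ℕ) + 1)) = ρ ^ (lam - d) * (ρ ^ ν) ^ r * ρ ^ j := by
      rw [hd1, ← Real.rpow_natCast (ρ ^ ν), ← Real.rpow_natCast ρ, ← Real.rpow_mul hρ.le,
        ← Real.rpow_add hρ, ← Real.rpow_add hρ]
      ring_nf
    have h2 : -(k * ρ ^ ν) * f₀ = -(k * f₀) * ρ ^ ν := by ring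
    rw [← hρdef, h1, h2, show (-(k * ρ ^ ν)) ^ r = (-k) ^ r * (ρ ^ ν) ^ r by rw [← neg_mul, mul_pow]]
    ring
  have hR : ρ ^ ((N : ℝ) + lam - ((d - 1 : ℕ) + 1)) = ρ ^ (lam - d) * ρ ^ N := by
    rw [hd1, ← Real.rpow_natCast ρ, ← Real.rpow_add hρ]
    ring_nf
  rw [hA, hM, ← mul_sub, norm_mul, Real.norm_of_nonneg (Real.rpow_nonneg hρ.le _)]
  refine (mul_le_mul_of_nonneg_left key (Real.rpow_nonneg hρ.le _)).trans_eq ?_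
  rw [Real.norm_of_nonneg (by positivity), hR,
    show -(k * ρ ^ ν) * (f₀ / 4) = -(k * (f₀ / 4)) * ρ ^ ν by ring]
  ring

theorem continuous_orderedProductSum {S : Type*} [TopologicalSpace S] {N : ℕ} {a : ℕ → S → ℝ}
    (ha : ∀ j ≤ N, Continuous (a j)) (r m : ℕ) (hm : m ≤ N) :
    Continuous fun Ω => orderedProductSum (fun n => a n Ω) m r := by
  induction r generalizing m with
  | zero =>
    simp only [orderedProductSum_zero]
    exact continuous_const
  | succ r ih =>
    simp only [orderedProductSum_succ]
    refine continuous_finsetSum _ fun p hp => ?_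
    have hp' := Finset.HasAntidiagonal.mem_antidiagonal.1 hp
    refine Continuous.mul ?_ (ih p.2 (by omega))
    split_ifs
    · exact continuous_const
    · exact ha _ (by omega)

theorem integrable_mul_orderedProductSum {d N : ℕ} {fc : ℕ → UnitSphere d → ℝ}
    (hfc : ∀ j ≤ N, Continuous (fc j)) {h : UnitSphere d → ℝ}
    (hh : Integrable h (sphereMeasure d)) (r m : ℕ) (hm : m ≤ N) :
    Integrable (fun Ω => h Ω * orderedProductSum (fun n => fc n Ω) m r) (sphereMeasure d) := by
  have hc := continuous_orderedProductSum hfc r m hm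
  obtain ⟨C, hC⟩ := isCompact_univ.exists_bound_of_continuousOn hc.continuousOn
  exact hh.mul_bdd (c := C) hc.aestronglyMeasurable (Eventually.of_forall fun Ω => hC Ω trivial)

theorem integrable_powMulCoeff {d N : ℕ} {fc gc : ℕ → UnitSphere d → ℝ}
    (hfc : ∀ j ≤ N, Continuous (fc j)) (hgc : ∀ j ≤ N, Integrable (gc j) (sphereMeasure d))
    (r j : ℕ) (hj : j ≤ N) :
    Integrable (fun Ω => powMulCoeff (fun n => fc n Ω) (fun n => gc n Ω) r j)
      (sphereMeasure d) := by
  unfold powMulCoeff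
  refine integrable_finsetSum _ fun p hp => ?_
  have hp' := Finset.HasAntidiagonal.mem_antidiagonal.1 hp
  simpa only [mul_comm] using
    integrable_mul_orderedProductSum hfc (hgc p.2 (by omega)) r p.1 (by omega)

/-- Both sides satisfy the same first-order recursion in `r`: `(-1)^r r!` times the binomial
coefficient is the rising factorial `a (a + 1) ⋯ (a + r - 1) = Γ(a + r)/Γ(a)`. -/
theorem choose_neg_mul_Gamma {a : ℝ} (ha : 0 < a) (r : ℕ) :
    Ring.choose (-a) r * Real.Gamma a = (-1) ^ r / r.factorial * Real.Gamma (a + r) := by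
  induction r with
  | zero => simp
  | succ r ih =>
    have h1 : ((r : ℝ) + 1) * Ring.choose (-a) (r + 1) = (-a - r) * Ring.choose (-a) r := by
      rw [Ring.choose_eq_smul, Ring.choose_eq_smul, descPochhammer_succ_right,
        Polynomial.smeval_mul]
      simp only [Polynomial.smeval_sub, Polynomial.smeval_X, Polynomial.smeval_natCast, pow_one,
        pow_zero, smul_eq_mul, nsmul_eq_mul, mul_one, Nat.factorial_succ]
      push_cast
      have : (r.factorial : ℝ) ≠ 0 := by positivity
      field_simp
    have h2 : Real.Gamma (a + (r + 1 : ℕ)) = (a + r) * Real.Gamma (a + r) := by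
      push_cast
      rw [← add_assoc, Real.Gamma_add_one (by positivity)]
    have h3 : ((r + 1).factorial : ℝ) = (r + 1) * r.factorial := by
      push_cast [Nat.factorial_succ]
      ring
    have h4 : (r : ℝ) + 1 ≠ 0 := by positivity
    have h5 : (r.factorial : ℝ) ≠ 0 := by positivity
    rw [h2, h3]
    apply mul_left_cancel₀ h4
    rw [← mul_assoc, h1, mul_assoc, ih]
    field_simp
    ring

/-- The triangular range `1 ≤ r ≤ m` can be enlarged to all `r ≤ N`, since the added ordered product
sums vanish for `r > m` and for `r = 0 < m`. The pair `m = r = 0` gives `∫ g_j`. -/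
theorem laplaceCoeff_eq {d N : ℕ} {ν lam f₀ : ℝ} {fc gc : ℕ → UnitSphere d → ℝ}
    (hfc : ∀ j ≤ N, Continuous (fc j)) (hgc : ∀ j ≤ N, Integrable (gc j) (sphereMeasure d))
    {j : ℕ} (hj : j ≤ N) :
    laplaceCoeff ν lam f₀ fc gc j =
      1 / ν * Real.Gamma ((j + lam) / ν) * f₀ ^ (-((j + lam) / ν)) *
        ∑ r ∈ Finset.range (N + 1), Ring.choose (-((j + lam) / ν)) r * f₀ ^ (-(r : ℤ)) *
          ∫ Ω, powMulCoeff (fun n => fc n Ω) (fun n => gc n Ω) r j ∂(sphereMeasure d) := by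
  unfold laplaceCoeff
  congr 1
  have hint : ∀ r, ∫ Ω, powMulCoeff (fun n => fc n Ω) (fun n => gc n Ω) r j ∂(sphereMeasure d) =
      ∑ m ∈ Finset.range (j + 1),
        ∫ Ω, gc (j - m) Ω * orderedProductSum (fun n => fc n Ω) m r ∂(sphereMeasure d) := by
    intro r
    unfold powMulCoeff
    simp only [Finset.Nat.sum_antidiagonal_eq_sum_range_succ_mk]
    rw [integral_finsetSum]
    · simp only [mul_comm]
    · intro m hm
      have := Finset.mem_range.1 hm
      simpa only [mul_comm] using
        integrable_mul_orderedProductSum hfc (hgc (j - m) (by omega)) r m (by omega)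
  simp only [hint, Finset.mul_sum]
  rw [Finset.sum_comm]
  refine Finset.sum_congr rfl fun m hm => ?_
  have hm := Finset.mem_range.1 hm
  split_ifs with h0
  · subst h0
    rw [Finset.sum_eq_single 0]
    · simp [orderedProductSum_zero]
    · intro r _ hr
      simp [orderedProductSum_eq_zero_of_lt _ (Nat.pos_of_ne_zero hr)]
    · simp
  · refine Finset.sum_subset (fun r hr => ?_) (fun r _ hr' => ?_)
    · simp only [Finset.mem_Icc, Finset.mem_range] at *
      omega
    · rw [Finset.mem_Icc, not_and_or, not_le, not_le, Nat.lt_one_iff] at hr'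
      rcases hr' with rfl | hr'
      · simp [orderedProductSum_zero, h0]
      · simp [orderedProductSum_eq_zero_of_lt _ hr']

/-! ### Integrating the model integrand -/

section Main

variable {d N : ℕ} {ν lam f₀ : ℝ} {fc gc : ℕ → UnitSphere d → ℝ}

theorem integrable_polar_mul_rpow_exp {h : UnitSphere d → ℝ} (hh : Integrable h (sphereMeasure d))
    {q b : ℝ} (hν : 0 < ν) (hq : 0 < q) (hb : 0 < b) :
    Integrable (fun p : UnitSphere d × Set.Ioi (0 : ℝ) => h p.1 *
      ((p.2 : ℝ) ^ (q - ((d - 1 : ℕ) + 1)) * Real.exp (-b * (p.2 : ℝ) ^ ν))) (polarMeasure d) :=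
  hh.mul_prod (integrable_volumeIoiPow_rpow_mul_exp (d - 1) hν hq hb)

theorem integral_polar_mul_rpow_exp (h : UnitSphere d → ℝ)
    {q b : ℝ} (hν : 0 < ν) (hq : 0 < q) (hb : 0 < b) :
    ∫ p : UnitSphere d × Set.Ioi (0 : ℝ), h p.1 *
      ((p.2 : ℝ) ^ (q - ((d - 1 : ℕ) + 1)) * Real.exp (-b * (p.2 : ℝ) ^ ν)) ∂(polarMeasure d) =
    (∫ Ω, h Ω ∂(sphereMeasure d)) * (b ^ (-(q / ν)) * (1 / ν) * Real.Gamma (q / ν)) := by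
  rw [← integral_volumeIoiPow_rpow_mul_exp (d - 1) hν hq hb]
  exact integral_prod_mul h fun ρ : Set.Ioi (0 : ℝ) =>
    (ρ : ℝ) ^ (q - ((d - 1 : ℕ) + 1)) * Real.exp (-b * (ρ : ℝ) ^ ν)

theorem integrable_laplaceMain (hν : 0 < ν) (hlam : 0 < lam) (hf₀ : 0 < f₀)
    (hfc : ∀ j ≤ N, Continuous (fc j)) (hgc : ∀ j ≤ N, Integrable (gc j) (sphereMeasure d))
    {k : ℝ} (hk : 0 < k) :
    Integrable (laplaceMain ν lam f₀ N fc gc k) (polarMeasure d) := by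
  unfold laplaceMain
  refine integrable_finsetSum _ fun r _ => integrable_finsetSum _ fun j hj => ?_
  have hj := Finset.mem_range.1 hj
  exact (integrable_polar_mul_rpow_exp (integrable_powMulCoeff hfc hgc r j (by omega)) hν
    (by positivity) (by positivity)).const_mul _

theorem integral_laplaceMain (hν : 0 < ν) (hlam : 0 < lam) (hf₀ : 0 < f₀)
    (hfc : ∀ j ≤ N, Continuous (fc j)) (hgc : ∀ j ≤ N, Integrable (gc j) (sphereMeasure d))
    {k : ℝ} (hk : 0 < k) :
    ∫ p, laplaceMain ν lam f₀ N fc gc k p ∂(polarMeasure d) =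
      ∑ j ∈ Finset.range (N + 1), laplaceCoeff ν lam f₀ fc gc j * k ^ (-((j + lam) / ν)) := by
  unfold laplaceMain
  have hI : ∀ r, ∀ j ∈ Finset.range (N + 1), Integrable
      (fun p : UnitSphere d × Set.Ioi (0 : ℝ) => ((-k) ^ r / r.factorial) *
        (powMulCoeff (fun n => fc n p.1) (fun n => gc n p.1) r j *
        ((p.2 : ℝ) ^ (ν * r + j + lam - ((d - 1 : ℕ) + 1)) *
        Real.exp (-(k * f₀) * (p.2 : ℝ) ^ ν)))) (polarMeasure d) := by
    intro r j hj
    have hj := Finset.mem_range.1 hj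
    exact (integrable_polar_mul_rpow_exp (integrable_powMulCoeff hfc hgc r j (by omega)) hν
      (by positivity) (by positivity)).const_mul _
  rw [integral_finsetSum _ fun r _ => integrable_finsetSum _ (hI r)]
  simp_rw [integral_finsetSum _ (hI _)]
  rw [Finset.sum_comm]
  refine Finset.sum_congr rfl fun j hj => ?_
  have hj := Finset.mem_range.1 hj
  rw [laplaceCoeff_eq hfc hgc (by omega : j ≤ N), Finset.mul_sum, Finset.sum_mul]
  refine Finset.sum_congr rfl fun r _ => ?_
  rw [integral_const_mul, integral_polar_mul_rpow_exp
    (fun Ω => powMulCoeff (fun n => fc n Ω) (fun n => gc n Ω) r j) hν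
    (by positivity) (by positivity)]
  -- The radial integral brings `(k f₀)^(-(a + r))` with `a = (j + λ)/ν`; its `k^(-r)` cancels the
  -- Taylor factor `k^r`.
  have ha : 0 < (j + lam) / ν := by positivity
  have hq : (ν * r + j + lam) / ν = (j + lam) / ν + r := by
    field_simp
    ring
  rw [hq]
  set a := (j + lam) / ν with hadef
  have hc := choose_neg_mul_Gamma ha r
  have hpow : ∀ x : ℝ, 0 < x → x ^ (-(a + r)) = x ^ (-a) * (x ^ r)⁻¹ := by
    intro x hx
    rw [neg_add, Real.rpow_add hx, Real.rpow_neg hx.le r, Real.rpow_natCast]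
  rw [Real.mul_rpow hk.le hf₀.le, hpow k hk, hpow f₀ hf₀, zpow_neg, zpow_natCast, neg_pow k]
  have hk' : k ^ r * (k ^ r)⁻¹ = 1 := mul_inv_cancel₀ (by positivity)
  set T := ∫ Ω, powMulCoeff (fun n => fc n Ω) (fun n => gc n Ω) r j ∂(sphereMeasure d)
  linear_combination (T * k ^ (-a) * f₀ ^ (-a) * (f₀ ^ r)⁻¹ * (1 / ν) * ((-1) ^ r / r.factorial) *
    Real.Gamma (a + r)) * hk' - (1 / ν * f₀ ^ (-a) * (f₀ ^ r)⁻¹ * T * k ^ (-a)) * hc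

theorem isLittleO_setIntegral_laplaceMain_compl (hν : 0 < ν) (hlam : 0 < lam) (hf₀ : 0 < f₀)
    (hfc : ∀ j ≤ N, Continuous (fc j)) (hgc : ∀ j ≤ N, Integrable (gc j) (sphereMeasure d))
    {δ : ℝ} (hδ : 0 < δ) (q : ℝ) :
    (fun k : ℝ => ∫ p in (polarBall d δ)ᶜ, laplaceMain ν lam f₀ N fc gc k p ∂(polarMeasure d))
      =o[atTop] fun k => k ^ q := by
  have hI : ∀ k : ℝ, 0 < k → ∀ r, ∀ j ∈ Finset.range (N + 1), Integrable
      (fun p : UnitSphere d × Set.Ioi (0 : ℝ) =>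
        (powMulCoeff (fun n => fc n p.1) (fun n => gc n p.1) r j *
        ((p.2 : ℝ) ^ (ν * r + j + lam - ((d - 1 : ℕ) + 1)) *
        Real.exp (-(k * f₀) * (p.2 : ℝ) ^ ν)))) (polarMeasure d) := by
    intro k hk r j hj
    have hj := Finset.mem_range.1 hj
    exact integrable_polar_mul_rpow_exp (integrable_powMulCoeff hfc hgc r j (by omega)) hν
      (by positivity) (by positivity)
  have hterm : ∀ r, ∀ j ∈ Finset.range (N + 1), (fun k : ℝ => ((-k) ^ r / r.factorial) *
      ∫ p in (polarBall d δ)ᶜ, (powMulCoeff (fun n => fc n p.1) (fun n => gc n p.1) r j *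
        ((p.2 : ℝ) ^ (ν * r + j + lam - ((d - 1 : ℕ) + 1)) *
        Real.exp (-(k * f₀) * (p.2 : ℝ) ^ ν))) ∂(polarMeasure d)) =o[atTop] fun k => k ^ q := by
    intro r j hj
    -- Outside the ball the phase `f₀ ρ^ν` is at least `f₀ δ^ν`; the target exponent `q - r` makes
    -- room for the prefactor `k^r`.
    have h1 := isLittleO_integral_exp_neg_mul
      (μ := (polarMeasure d).restrict (polarBall d δ)ᶜ)
      (ψ := fun p => f₀ * (p.2 : ℝ) ^ ν) (k₀ := 1)
      (h := fun p => powMulCoeff (fun n => fc n p.1) (fun n => gc n p.1) r j *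
        (p.2 : ℝ) ^ (ν * r + j + lam - ((d - 1 : ℕ) + 1)))
      (A := f₀ * δ ^ ν) (by positivity) ?_ ?_ (q - r)
    · have h2 : (fun k : ℝ => (-k) ^ r / r.factorial) =O[atTop] fun k : ℝ => k ^ (r : ℝ) := by
        refine IsBigO.of_bound (1 / r.factorial) ?_
        filter_upwards [eventually_ge_atTop 0] with k hk
        rw [Real.rpow_natCast, norm_div, norm_pow, norm_neg, norm_pow]
        simp [div_eq_inv_mul]
      refine (h2.mul_isLittleO h1).congr' ?_ ?_
      · refine Eventually.of_forall fun k => ?_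
        simp only
        congr 1
        refine integral_congr_ae (Eventually.of_forall fun p => ?_)
        simp only
        rw [show -k * (f₀ * (p.2 : ℝ) ^ ν) = -(k * f₀) * (p.2 : ℝ) ^ ν by ring]
        ring
      · filter_upwards [eventually_gt_atTop 0] with k hk
        rw [← Real.rpow_add hk]
        ring_nf
    · refine (ae_restrict_iff' (measurableSet_polarBall d δ).compl).2
        (Eventually.of_forall fun p hp => ?_)
      have : δ ≤ (p.2 : ℝ) := not_lt.1 hp
      gcongr
    · refine ((hI 1 one_pos r j hj).integrableOn (s := (polarBall d δ)ᶜ)).congr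
        (Eventually.of_forall fun p => ?_)
      simp only
      rw [show -1 * (f₀ * (p.2 : ℝ) ^ ν) = -(1 * f₀) * (p.2 : ℝ) ^ ν by ring]
      ring
  have hsum := IsLittleO.fun_sum fun r (_ : r ∈ Finset.range (N + 1)) =>
    IsLittleO.fun_sum fun j hj => hterm r j hj
  refine hsum.congr' ?_ EventuallyEq.rfl
  filter_upwards [eventually_gt_atTop 0] with k hk
  unfold laplaceMain
  have hI' : ∀ r, ∀ j ∈ Finset.range (N + 1), Integrable
      (fun p : UnitSphere d × Set.Ioi (0 : ℝ) => ((-k) ^ r / r.factorial) *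
        (powMulCoeff (fun n => fc n p.1) (fun n => gc n p.1) r j *
        ((p.2 : ℝ) ^ (ν * r + j + lam - ((d - 1 : ℕ) + 1)) *
        Real.exp (-(k * f₀) * (p.2 : ℝ) ^ ν)))) ((polarMeasure d).restrict (polarBall d δ)ᶜ) :=
    fun r j hj => ((hI k hk r j hj).const_mul _).integrableOn
  rw [integral_finsetSum _ fun r _ => integrable_finsetSum _ (hI' r)]
  refine Finset.sum_congr rfl fun r _ => ?_
  rw [integral_finsetSum _ (hI' r)]
  refine Finset.sum_congr rfl fun j _ => ?_
  rw [integral_const_mul]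

end Main

/-! ### Integrability of the coefficients of `g` and of the integrand -/

theorem eventually_le_one_of_hasRadialExpansion {d : ℕ} {f : EuclideanSpace ℝ (Fin d) → ℝ}
    {ν : ℝ} (hν : 0 < ν) {N : ℕ} (hN : 0 < N) {fc : ℕ → UnitSphere d → ℝ}
    (hfc : ∀ j ≤ N, Continuous (fc j)) (hfexp : HasRadialExpansion f ν N fc) :
    ∀ᶠ ρ in 𝓝[>] (0 : ℝ), ∀ Ω : UnitSphere d, f (ρ • (Ω : EuclideanSpace ℝ (Fin d))) ≤ 1 := by
  have h1 : (fun p : ℝ × UnitSphere d =>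
      p.1 ^ (-ν) * f (p.1 • (p.2 : EuclideanSpace ℝ (Fin d))))
      =O[(𝓝[>] (0 : ℝ)) ×ˢ (⊤ : Filter (UnitSphere d))] fun _ => (1 : ℝ) := by
    simpa using ((tendsto_radialQuotient_sub hN hfc hfexp).isBigO_one ℝ).add
      (isBigO_one_of_continuous (hfc 0 (Nat.zero_le _)) _)
  have h2 : Tendsto (fun p : ℝ × UnitSphere d => p.1 ^ ν)
      ((𝓝[>] (0 : ℝ)) ×ˢ (⊤ : Filter (UnitSphere d))) (𝓝 0) := by
    have := (Real.continuousAt_rpow_const 0 ν (Or.inr hν.le)).tendsto.comp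
      (tendsto_radial_fst (d := d))
    rwa [Real.zero_rpow hν.ne'] at this
  have h3 := ((isBigO_refl (fun p : ℝ × UnitSphere d => p.1 ^ ν)
    ((𝓝[>] (0 : ℝ)) ×ˢ (⊤ : Filter (UnitSphere d)))).mul h1).trans_tendsto (by simpa using h2)
  refine (eventually_radial_iff
    (P := fun p : ℝ × UnitSphere d => f (p.1 • (p.2 : EuclideanSpace ℝ (Fin d))) ≤ 1)).1 ?_
  filter_upwards [h3.eventually_lt_const one_pos, eventually_radial_pos] with p hp hp0
  rw [← mul_assoc, ← Real.rpow_add hp0] at hp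
  simpa using hp.le

theorem integrable_radialCoeff {d : ℕ} (hd : 0 < d) {g : EuclideanSpace ℝ (Fin d) → ℝ} {s : ℝ}
    {N : ℕ} {gc : ℕ → UnitSphere d → ℝ} (hgexp : HasRadialExpansion g s N gc) {δ : ℝ} (hδ : 0 < δ)
    (hg : IntegrableOn g (Metric.ball 0 δ)) {j : ℕ} (hj : j ≤ N) :
    Integrable (gc j) (sphereMeasure d) := by
  have hprod := (integrableOn_polarBall_iff hd δ g).2 hg
  rw [← integrable_indicator_iff (measurableSet_polarBall d δ)] at hprod
  have hae := hprod.prod_left_ae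
  have hfreq : ∃ᶠ ρ in 𝓝[>] (0 : ℝ), Integrable
      (fun Ω : UnitSphere d => ρ ^ (-s) * g (ρ • (Ω : EuclideanSpace ℝ (Fin d))))
      (sphereMeasure d) := by
    rw [frequently_iff]
    intro U hU
    obtain ⟨ε, hε, hεU⟩ := mem_nhdsGT_iff_exists_Ioo_subset.1 hU
    have hε : 0 < ε := hε
    -- Every interval `(0, min ε δ)` has positive radial measure, so it contains a radius at which
    -- the almost-everywhere slice integrability holds.
    have hne : Measure.volumeIoiPow (d - 1) (Set.Iio ⟨min ε δ, lt_min hε hδ⟩) ≠ 0 := by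
      rw [Measure.volumeIoiPow_apply_Iio]
      have := lt_min hε hδ
      simp only [ne_eq, ENNReal.ofReal_eq_zero, not_le]
      positivity
    obtain ⟨ρ, hρ1, hρ2⟩ := ((frequently_ae_mem_iff.2 hne).and_eventually hae).exists
    have hρ1 : (ρ : ℝ) < min ε δ := hρ1
    refine ⟨ρ, hεU ⟨ρ.2, hρ1.trans_le (min_le_left _ _)⟩, Integrable.const_mul ?_ _⟩
    refine hρ2.congr (Eventually.of_forall fun Ω => ?_)
    exact Set.indicator_of_mem (show (Ω, ρ) ∈ polarBall d δ from
      hρ1.trans_le (min_le_right _ _)) _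
  have hnorm := hgexp.normalized
  have hmeas : ∀ j ≤ N, AEStronglyMeasurable (gc j) (sphereMeasure d) :=
    aestronglyMeasurable_coeff
      (v := fun ρ Ω => ρ ^ (-s) * g (ρ • (Ω : EuclideanSpace ℝ (Fin d))))
      (fun Ω => hnorm.comp_tendsto (tendsto_id.prodMk (tendsto_top (f := fun _ : ℝ => Ω))))
      (hfreq.mono fun ρ h => h.aestronglyMeasurable)
  have hbound := eventually_radial_iff.1 ((isLittleO_iff.1 hnorm) one_pos)
  have hfreq2 := hfreq.and_eventually hbound
  have hinf : {ρ : ℝ | Integrable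
      (fun Ω : UnitSphere d => ρ ^ (-s) * g (ρ • (Ω : EuclideanSpace ℝ (Fin d))))
      (sphereMeasure d) ∧ ∀ Ω : UnitSphere d,
        ‖ρ ^ (-s) * g (ρ • (Ω : EuclideanSpace ℝ (Fin d))) -
          ∑ j ∈ Finset.range (N + 1), gc j Ω * ρ ^ j‖ ≤ 1 * ‖ρ ^ N‖}.Infinite := by
    intro hfin
    have hmem : {ρ : ℝ | Integrable
      (fun Ω : UnitSphere d => ρ ^ (-s) * g (ρ • (Ω : EuclideanSpace ℝ (Fin d))))
      (sphereMeasure d) ∧ ∀ Ω : UnitSphere d,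
        ‖ρ ^ (-s) * g (ρ • (Ω : EuclideanSpace ℝ (Fin d))) -
          ∑ j ∈ Finset.range (N + 1), gc j Ω * ρ ^ j‖ ≤ 1 * ‖ρ ^ N‖}ᶜ ∈ 𝓝[>] (0 : ℝ) := by
      -- The point `0` may itself belong to the set; it is removed so that the complement of the
      -- finite remainder is a neighbourhood of `0`.
      have h1 := (hfin.subset (Set.sdiff_subset (t := {0}))).isClosed.isOpen_compl.mem_nhds
        (show (0 : ℝ) ∈ _ by simp)
      filter_upwards [mem_nhdsWithin_of_mem_nhds h1, self_mem_nhdsWithin] with ρ hρ hρ0 hmem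
      exact hρ ⟨hmem, ne_of_gt hρ0⟩
    exact hfreq2 hmem
  have t := hinf.natEmbedding
  refine integrable_coeff_of_integrable_sum (t := fun i : Fin (N + 1) => (t i : ℝ))
    (fun i i' h => Fin.ext (t.injective (Subtype.ext h))) (fun i => ?_) hj
  obtain ⟨h1, h2⟩ := (t i).2
  have hm : AEStronglyMeasurable (fun Ω => ∑ j ∈ Finset.range (N + 1), gc j Ω * (t i : ℝ) ^ j)
      (sphereMeasure d) :=
    Finset.aestronglyMeasurable_fun_sum _ fun j hj =>
      (hmeas j (Nat.lt_succ_iff.1 (Finset.mem_range.1 hj))).mul_const _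
  -- The slice minus its polynomial is bounded on a sphere of finite measure, so the polynomial
  -- inherits integrability from the slice.
  have h3 : Integrable (fun Ω : UnitSphere d =>
      (t i : ℝ) ^ (-s) * g ((t i : ℝ) • (Ω : EuclideanSpace ℝ (Fin d))) -
        ∑ j ∈ Finset.range (N + 1), gc j Ω * (t i : ℝ) ^ j) (sphereMeasure d) :=
    (integrable_const (1 * ‖(t i : ℝ) ^ N‖)).mono' (h1.aestronglyMeasurable.sub hm)
      (Eventually.of_forall h2)
  exact (h1.sub h3).congr (Eventually.of_forall fun Ω => sub_sub_cancel _ _)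

theorem integrableOn_laplace {d : ℕ} {R : Set (EuclideanSpace ℝ (Fin d))}
    (hR : NullMeasurableSet R volume) {f g : EuclideanSpace ℝ (Fin d) → ℝ}
    (hf : AEMeasurable f (volume.restrict R)) (hg : AEMeasurable g (volume.restrict R))
    (hnonneg : ∀ x ∈ R, 0 ≤ f x) {k₀ k : ℝ} (hk : k₀ ≤ k)
    (hint : IntegrableOn (fun x => Real.exp (-k₀ * f x) * g x) R volume) :
    IntegrableOn (fun x => Real.exp (-k * f x) * g x) R volume := by
  refine hint.norm.mono' ?_ ?_
  · exact ((Real.measurable_exp.comp_aemeasurable (hf.const_mul (-k))).mul hg).aestronglyMeasurable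
  · filter_upwards [ae_restrict_mem₀ hR] with x hx
    rw [norm_mul, norm_mul, Real.norm_of_nonneg (Real.exp_pos _).le,
      Real.norm_of_nonneg (Real.exp_pos _).le]
    have := hnonneg x hx
    gcongr

/-! ### Assembling the asymptotic expansion -/

/-- The Laplace expansion when `|x|^{-ν} f(x)` has the limit `f₀ > 0` at the origin. -/
theorem isLittleO_laplace_sub_sum {d N : ℕ} (hd : 0 < d)
    {R : Set (EuclideanSpace ℝ (Fin d))} (hR : NullMeasurableSet R volume)
    (hR0 : (0 : EuclideanSpace ℝ (Fin d)) ∈ interior R)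
    {f g : EuclideanSpace ℝ (Fin d) → ℝ}
    (hfaway : ∀ δ : ℝ, 0 < δ → ∃ A : ℝ, 0 < A ∧ ∀ x ∈ R, δ ≤ ‖x‖ → A ≤ f x)
    (hN : 0 < N) {ν lam f₀ : ℝ} (hν : 0 < ν) (hlam : 0 < lam) (hf₀ : 0 < f₀)
    {fc gc : ℕ → UnitSphere d → ℝ}
    (hfc : ∀ j ≤ N, Continuous (fc j)) (hconst : ∀ Ω, fc 0 Ω = f₀)
    (hfexp : HasRadialExpansion f ν N fc) (hgexp : HasRadialExpansion g (lam - d) N gc)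
    (hgc : ∀ j ≤ N, Integrable (gc j) (sphereMeasure d)) {k₀ : ℝ}
    (hint : ∀ k, k₀ ≤ k → IntegrableOn (fun x => Real.exp (-k * f x) * g x) R volume) :
    (fun k : ℝ => (∫ x in R, Real.exp (-k * f x) * g x)
        - ∑ j ∈ Finset.range (N + 1), laplaceCoeff ν lam f₀ fc gc j * k ^ (-((j + lam) / ν)))
      =o[atTop] fun k : ℝ => k ^ (-((N + lam) / ν)) := by
  set G : UnitSphere d → ℝ := fun Ω => 1 + ∑ j ∈ Finset.range (N + 1), |gc j Ω| with hGdef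
  have hGint : Integrable G (sphereMeasure d) :=
    (integrable_const 1).add (integrable_finsetSum _ fun j hj =>
      (hgc j (Nat.lt_succ_iff.1 (Finset.mem_range.1 hj))).abs)
  have hG0 : ∀ Ω, 0 ≤ G Ω := fun Ω =>
    add_nonneg zero_le_one (Finset.sum_nonneg fun _ _ => abs_nonneg _)
  have hNlam : 0 < (N : ℝ) + lam := by positivity
  -- `C` is the integral of the pointwise majorant at `k = 1`; for general `k` it scales by `k^(-(N
  -- + λ)/ν)`.
  set C : ℝ := (∫ Ω, G Ω ∂(sphereMeasure d)) *
    ((f₀ / 4) ^ (-((N + lam) / ν)) * (1 / ν) * Real.Gamma ((N + lam) / ν)) with hC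
  have hC0 : 0 ≤ C := by
    have h1 : 0 ≤ ∫ Ω, G Ω ∂(sphereMeasure d) := integral_nonneg fun Ω => hG0 Ω
    have h2 := Real.Gamma_pos_of_pos (div_pos hNlam hν)
    have h3 := Real.rpow_nonneg (by positivity : 0 ≤ f₀ / 4) (-((N + lam) / ν))
    positivity
  rw [isLittleO_iff]
  intro c hc
  obtain ⟨ε, hε, hεR⟩ := Metric.mem_nhds_iff.1 (mem_interior_iff_mem_nhds.1 hR0)
  -- This gives the inner error the share `c/2`, with `C + 1` avoiding division by zero; the two
  -- tails receive `c/4` each.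
  have hη : 0 < c / (2 * (C + 1)) := by positivity
  obtain ⟨δ, hδbound, hδ0, hδε⟩ := ((norm_laplace_sub_laplaceMain_le hd hN hf₀ hfc hconst hfexp
    hgexp hη).and (Ioo_mem_nhdsGT hε)).exists
  have hball : R ∩ Metric.ball 0 δ = Metric.ball 0 δ :=
    Set.inter_eq_right.2 ((Metric.ball_subset_ball hδε.le).trans hεR)
  obtain ⟨A, hA, hAf⟩ := hfaway δ hδ0
  have houter := isLittleO_integral_exp_neg_mul (μ := volume.restrict (R \ Metric.ball 0 δ))
    (ψ := f) (h := g) hA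
    (by
      filter_upwards [ae_restrict_mem₀ (hR.diff measurableSet_ball.nullMeasurableSet)] with x hx
      exact hAf x hx.1 (by simpa using hx.2))
    ((hint k₀ le_rfl).mono_set Set.sdiff_subset) (-((N + lam) / ν))
  have hinner := isLittleO_setIntegral_laplaceMain_compl hν hlam hf₀ hfc hgc hδ0 (-((N + lam) / ν))
  filter_upwards [isLittleO_iff.1 houter (by positivity : 0 < c / 4),
    isLittleO_iff.1 hinner (by positivity : 0 < c / 4), eventually_ge_atTop k₀,
    eventually_gt_atTop 0] with k ho hi hkk₀ hk
  have hF := hint k hkk₀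
  have hFball : IntegrableOn (fun x => Real.exp (-k * f x) * g x) (Metric.ball 0 δ) :=
    hball ▸ hF.mono_set Set.inter_subset_left
  have hM := integrable_laplaceMain hν hlam hf₀ hfc hgc hk
  have hsplitR := integral_inter_add_sdiff measurableSet_ball hF (t := Metric.ball 0 δ)
  rw [hball, ← setIntegral_polarBall hd] at hsplitR
  have hsplitM := integral_add_compl (measurableSet_polarBall d δ) hM
  rw [integral_laplaceMain hν hlam hf₀ hfc hgc hk] at hsplitM
  have hdiff := integral_sub ((integrableOn_polarBall_iff hd δ _).2 hFball)
    (hM.integrableOn (s := polarBall d δ))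
  have hmid : ‖∫ p in polarBall d δ,
      (Real.exp (-k * f ((p.2 : ℝ) • (p.1 : EuclideanSpace ℝ (Fin d)))) *
        g ((p.2 : ℝ) • (p.1 : EuclideanSpace ℝ (Fin d))) - laplaceMain ν lam f₀ N fc gc k p)
        ∂(polarMeasure d)‖ ≤ c / 2 * k ^ (-((N + lam) / ν)) := by
    have hk4 : 0 < k * (f₀ / 4) := by positivity
    have hE := (integrable_polar_mul_rpow_exp (d := d) hGint hν hNlam hk4).const_mul
      (c / (2 * (C + 1)))
    refine (norm_integral_le_of_norm_le hE.integrableOn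
      ((ae_restrict_iff' (measurableSet_polarBall d δ)).2
        (Eventually.of_forall fun p hp => hδbound k hk.le p hp))).trans ?_
    refine (setIntegral_le_integral hE (Eventually.of_forall fun p => ?_)).trans ?_
    · have := hG0 p.1
      have hp : 0 < (p.2 : ℝ) := p.2.2
      exact mul_nonneg hη.le (mul_nonneg this (by positivity))
    · rw [integral_const_mul, integral_polar_mul_rpow_exp G hν hNlam hk4,
        Real.mul_rpow hk.le (by positivity)]
      have hkp := Real.rpow_nonneg hk.le (-((N + lam) / ν))
      calc _ = c / 2 * k ^ (-((N + lam) / ν)) * (C / (C + 1)) := by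
            rw [hC]
            field_simp
        _ ≤ c / 2 * k ^ (-((N + lam) / ν)) * 1 := by
            gcongr
            rw [div_le_one (by positivity)]
            linarith
        _ = _ := mul_one _
  have hkey : (∫ x in R, Real.exp (-k * f x) * g x) -
      ∑ j ∈ Finset.range (N + 1), laplaceCoeff ν lam f₀ fc gc j * k ^ (-((j + lam) / ν)) =
      (∫ p in polarBall d δ,
      (Real.exp (-k * f ((p.2 : ℝ) • (p.1 : EuclideanSpace ℝ (Fin d)))) *
        g ((p.2 : ℝ) • (p.1 : EuclideanSpace ℝ (Fin d))) - laplaceMain ν lam f₀ N fc gc k p)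
        ∂(polarMeasure d)) + (∫ x in R \ Metric.ball 0 δ, Real.exp (-k * f x) * g x) -
      ∫ p in (polarBall d δ)ᶜ, laplaceMain ν lam f₀ N fc gc k p ∂(polarMeasure d) := by
    rw [hdiff, ← hsplitR, ← hsplitM]
    ring
  rw [hkey]
  rw [Real.norm_of_nonneg (Real.rpow_nonneg hk.le _)] at ho hi ⊢
  refine (norm_sub_le _ _).trans ?_
  have := norm_add_le (∫ p in polarBall d δ,
      (Real.exp (-k * f ((p.2 : ℝ) • (p.1 : EuclideanSpace ℝ (Fin d)))) *
        g ((p.2 : ℝ) • (p.1 : EuclideanSpace ℝ (Fin d))) - laplaceMain ν lam f₀ N fc gc k p)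
        ∂(polarMeasure d)) (∫ x in R \ Metric.ball 0 δ, Real.exp (-k * f x) * g x)
  linarith

theorem corollary3p2 (d : ℕ) (hd : 0 < d)
    (R : Set (EuclideanSpace ℝ (Fin d))) (hR : NullMeasurableSet R volume)
    (hR0 : (0 : EuclideanSpace ℝ (Fin d)) ∈ interior R)
    (f g : EuclideanSpace ℝ (Fin d) → ℝ)
    (hf : AEMeasurable f (volume.restrict R)) (hg : AEMeasurable g (volume.restrict R))
    (hf0 : f 0 = 0) (hfpos : ∀ x ∈ R, x ≠ 0 → 0 < f x)
    (hfaway : ∀ δ : ℝ, 0 < δ → ∃ A : ℝ, 0 < A ∧ ∀ x ∈ R, δ ≤ ‖x‖ → A ≤ f x)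
    (N : ℕ) (hN : 0 < N)
    (ν : ℝ) (hν : 0 < ν) (fc : ℕ → UnitSphere d → ℝ)
    (hfc : ∀ j ≤ N, Continuous (fc j)) (hfc0 : ∀ Ω, 0 < fc 0 Ω)
    (hfexp : HasRadialExpansion f ν N fc)
    (lam : ℝ) (hlam : 0 < lam) (gc : ℕ → UnitSphere d → ℝ)
    (hgexp : HasRadialExpansion g (lam - d) N gc)
    (k₀ : ℝ) (hk₀ : 0 < k₀)
    (hint : IntegrableOn (fun x => Real.exp (-k₀ * f x) * g x) R volume) :
    (RadialQuotientContinuousAtZero f ν ↔ ∃ c : ℝ, ∀ Ω, fc 0 Ω = c) ∧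
    (RadialQuotientContinuousAtZero f ν →
      ∃ f₀ : ℝ, 0 < f₀ ∧ (∀ Ω, fc 0 Ω = f₀) ∧
        (∀ k : ℝ, k₀ ≤ k → IntegrableOn (fun x => Real.exp (-k * f x) * g x) R volume) ∧
        (∀ j ≤ N, Integrable (gc j) (sphereMeasure d)) ∧
        (∀ j ≤ N, ∀ m ∈ Finset.Icc 1 j, ∀ r ∈ Finset.Icc 1 m,
          Integrable (fun Ω => gc (j - m) Ω * orderedProductSum (fun n => fc n Ω) m r)
            (sphereMeasure d)) ∧
        (fun k : ℝ => (∫ x in R, Real.exp (-k * f x) * g x)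
            - ∑ j ∈ Finset.range (N + 1),
                laplaceCoeff ν lam f₀ fc gc j * k ^ (-((j + lam) / ν)))
          =o[atTop] fun k : ℝ => k ^ (-((N + lam) / ν))) := by
  have hiff := radialQuotientContinuousAtZero_iff hN hfc hfexp
  refine ⟨hiff, fun hrad => ?_⟩
  obtain ⟨f₀, hconst⟩ := hiff.1 hrad
  have hf₀ : 0 < f₀ := by
    have : Nonempty (Fin d) := ⟨⟨0, hd⟩⟩
    -- Positivity of the constant is read off at a point of the sphere, which exists because `d >
    -- 0`.
    obtain ⟨x, hx⟩ := exists_norm_eq (EuclideanSpace ℝ (Fin d)) zero_le_one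
    have h := hfc0 ⟨x, by simpa using hx⟩
    rwa [hconst] at h
  have hnonneg : ∀ x ∈ R, 0 ≤ f x := by
    intro x hx
    rcases eq_or_ne x 0 with rfl | h
    · exact hf0.ge
    · exact (hfpos x hx h).le
  have hk : ∀ k : ℝ, k₀ ≤ k → IntegrableOn (fun x => Real.exp (-k * f x) * g x) R volume :=
    fun k hk => integrableOn_laplace hR hf hg hnonneg hk hint
  have hgc : ∀ j ≤ N, Integrable (gc j) (sphereMeasure d) := by
    obtain ⟨ε, hε, hεR⟩ := Metric.mem_nhds_iff.1 (mem_interior_iff_mem_nhds.1 hR0)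
    obtain ⟨δ₀, hδ₀, hle⟩ := mem_nhdsGT_iff_exists_Ioo_subset.1
      (eventually_le_one_of_hasRadialExpansion hν hN hfc hfexp)
    have hδ₀ : 0 < δ₀ := hδ₀
    have hsub : Metric.ball 0 (min ε δ₀) ⊆ R :=
      (Metric.ball_subset_ball (min_le_left _ _)).trans hεR
    -- On this ball `f ≤ 1`, so `|g| ≤ exp k₀ · |exp (-k₀ f) g|`.
    have hgball : IntegrableOn g (Metric.ball 0 (min ε δ₀)) := by
      refine ((hint.mono_set hsub).norm.const_mul (Real.exp k₀)).mono'
        (hg.mono_measure (Measure.restrict_mono hsub le_rfl)).aestronglyMeasurable ?_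
      filter_upwards [ae_restrict_mem measurableSet_ball] with x hx
      have hfx : f x ≤ 1 := by
        rcases eq_or_ne x 0 with rfl | h
        · rw [hf0]
          exact zero_le_one
        · have hx0 : ‖x‖ ≠ 0 := norm_ne_zero_iff.2 h
          have hxδ : ‖x‖ < δ₀ := (mem_ball_zero_iff.1 hx).trans_le (min_le_right _ _)
          have := hle ⟨norm_pos_iff.2 h, hxδ⟩ ⟨‖x‖⁻¹ • x, by simp [norm_smul, hx0]⟩
          simpa [smul_smul, hx0] using this
      rw [norm_mul, Real.norm_of_nonneg (Real.exp_pos _).le, ← mul_assoc, ← Real.exp_add]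
      refine le_mul_of_one_le_left (norm_nonneg _) (Real.one_le_exp ?_)
      nlinarith
    exact fun j hj => integrable_radialCoeff hd hgexp (lt_min hε hδ₀) hgball hj
  refine ⟨f₀, hf₀, hconst, hk, hgc, fun j hj m hm r _ => ?_,
    isLittleO_laplace_sub_sum hd hR hR0 hfaway hN hν hlam hf₀ hfc hconst hfexp hgexp hgc hk⟩
  have := (Finset.mem_Icc.1 hm).2
  exact integrable_mul_orderedProductSum hfc (hgc (j - m) (by omega)) r m (by omega)
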